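/- Let $\mathcal B$ be a unital $C^*$-algebra, $\mathcal C$ a von Neumann algebra acting on a Hilbert space $\mathcal H$, $\alpha$ a ($*$-)automorphism of $\mathcal B$ and $\Omega$ a set. A kernel is a map $\mathfrak K:\Omega\times\Omega\to\mathcal B(\mathcal B,\mathcal C)$ into the bounded linear maps. It is an $\alpha$-CPD-kernel, written $\mathfrak K\in\mathcal K^\alpha_\Omega(\mathcal B,\mathcal C)$, if $\mathfrak K^{\sigma,\sigma'}(b^*)=\mathfrak K^{\sigma',\sigma}(b)^*$ and for all finite families $\sigma_i\in\Omega$, $b_i\in\mathcal B$, $c_i\in\mathcal C$: (i) $\sum_{i,j}c_i^*\mathfrak K^{\sigma_i,\sigma_j}(\alpha(b_i)^*b_j)c_j\ge 0$; (ii) $\mathfrak K^{\sigma,\sigma'}(\alpha(b))=\mathfrak K^{\sigma,\sigma'}(b)$; (iii) for each $b\in\mathcal B$ there is $M(b)>0$, independent of the families, with $\|\sum_{i,j}c_i^*\mathfrak K^{\sigma_i,\sigma_j}(\alpha(b_i^*b^*)bb_j)c_j\|\le M(b)\|\sum_{i,j}c_i^*\mathfrak K^{\sigma_i,\sigma_j}(\alpha(b_i^*)b_j)c_j\|$.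 An S-correspondence from $\mathcal B$ to $\mathcal C$ is a (right) Hilbert $\mathcal C$-module $\mathcal F$ together with a unitary $U$ on $\mathcal F$ and a unital algebra homomorphism $\pi$ from $\mathcal B$ to the adjointable operators on $\mathcal F$ such that $\langle\pi(b)x,Uy\rangle=\langle x,U\pi(b^*)y\rangle$ for all $b\in\mathcal B$, $x,y\in\mathcal F$; write $bx=\pi(b)x$. For a kernel $\mathfrak K$ let $\mathcal S(\mathcal F,\mathfrak K)$ be the set of maps $\mathfrak i:\Omega\to\mathcal F$ such that, for all $\sigma,\sigma'\in\Omega$, $b\in\mathcal B$, $c\in\mathcal C$, $$\mathfrak K^{\sigma,\sigma'}(b)=\langle\mathfrak i(\sigma),b\,\mathfrak i(\sigma')\rangle=\langle\alpha(b^*)\mathfrak i(\sigma),\mathfrak i(\sigma')\rangle,\qquad U(b\,\mathfrak i(\sigma)c)=\alpha(b)\,\mathfrak i(\sigma)c .$$ A Kolmogorov decomposition of $\mathfrak K$ is a triple $(\mathcal F,U,\mathfrak i)$ where $\mathcal F$ is an S-correspondence with unitary $U$ that is a von Neumann $\mathcal C$-module (i.e. strongly closed in $\mathcal B(\mathcal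 H,\mathcal F\otimes\mathcal H)$, where $\mathcal F\otimes\mathcal H$ is the interior tensor product and $x\in\mathcal F$ acts by $h\mapsto x\otimes h$) and $\mathfrak i\in\mathcal S(\mathcal F,\mathfrak K)$; minimality is not required. $\mathcal F$ is a common S-correspondence for $\mathfrak K_1,\mathfrak K_2$ if $\mathcal S(\mathcal F,\mathfrak K_1)$ and $\mathcal S(\mathcal F,\mathfrak K_2)$ are non-empty. Put $$\beta_{\mathcal F}(\mathfrak K_1,\mathfrak K_2)=\inf\{\|\mathfrak i_1(\sigma)-\mathfrak i_2(\sigma)\|:\mathfrak i_m\in\mathcal S(\mathcal F,\mathfrak K_m)\ (m=1,2),\ \sigma\in\Omega\},\qquad \beta(\mathfrak K_1,\mathfrak K_2)=\inf_{\mathcal F}\beta_{\mathcal F}(\mathfrak K_1,\mathfrak K_2),$$ the last infimum being over all common S-correspondences $\mathcal F$ for $\mathfrak K_1$ and $\mathfrak K_2$. Theorem. Let $(\mathcal F_m,U_m,\mathfrak i_m)$ be a Kolmogorov decomposition of $\mathfrak K_m\in\mathcal K^\alpha_\Omega(\mathcal B,\mathcal C)$, $m=1,2$, and let $\mathcal F_1\oplus\mathcal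 F_2$ be the direct sum S-correspondence, with unitary $U_1\oplus U_2$ and left action $\pi_1\oplus\pi_2$. Then $$\beta(\mathfrak K_1,\mathfrak K_2)=\beta_{\mathcal F_1\oplus\mathcal F_2}(\mathfrak K_1,\mathfrak K_2)=\inf\{\|\mathfrak i_1(\sigma)\oplus 0-\mathfrak j(\sigma)\|:\mathfrak j\in\mathcal S(\mathcal F_1\oplus\mathcal F_2,\mathfrak K_2),\ \sigma\in\Omega\}.$$ -/

import Mathlib

/-! ## Von Neumann algebras on a Hilbert space as C⋆-algebras -/

section VonNeumann

variable {H : Type*} [NormedAddCommGroup H] [InnerProductSpace ℂ H] [CompleteSpace H]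

instance VonNeumannAlgebra.instSMulMemClassComplex :
    SMulMemClass (VonNeumannAlgebra H) ℂ (H →L[ℂ] H) where
  smul_mem {s} z _ hx := s.toStarSubalgebra.smul_mem hx z

instance VonNeumannAlgebra.instIsClosedCarrier (C : VonNeumannAlgebra H) :
    IsClosed (C : Set (H →L[ℂ] H)) := by
  rw [← C.centralizer_centralizer]
  exact Set.isClosed_centralizer _

instance VonNeumannAlgebra.instStarOrderedRingCarrier (C : VonNeumannAlgebra H) :
    StarOrderedRing C := by
  refine StarOrderedRing.of_nonneg_iff' (fun {x y} h z => ?_) (fun x => ⟨fun h => ?_, ?_⟩)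
  · have h' : (x : H →L[ℂ] H) ≤ y := h
    have : (z : H →L[ℂ] H) + x ≤ z + y := by gcongr
    exact this
  · have h' : 0 ≤ (x : H →L[ℂ] H) := h
    have hmem : CFC.sqrt (x : H →L[ℂ] H) ∈ C := by
      rw [← SetLike.mem_coe, ← C.centralizer_centralizer, Set.mem_centralizer_iff]
      intro m hm
      have hc : Commute (x : H →L[ℂ] H) m := hm _ x.2
      have := Commute.cfcₙ_nnreal hc NNReal.sqrt
      exact this.symm
    refine ⟨⟨_, hmem⟩, Subtype.ext ?_⟩
    have hs : star (CFC.sqrt (x : H →L[ℂ] H)) = CFC.sqrt (x : H →L[ℂ] H) :=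
      (CFC.sqrt_nonneg (x : H →L[ℂ] H)).isSelfAdjoint
    show (x : H →L[ℂ] H) = star (CFC.sqrt (x : H →L[ℂ] H)) * CFC.sqrt (x : H →L[ℂ] H)
    rw [hs, CFC.sqrt_mul_sqrt_self _ h']
  · rintro ⟨s, rfl⟩
    exact star_mul_self_nonneg (s : H →L[ℂ] H)

end VonNeumann

/-! ## Hilbert modules

A (right) Hilbert `C`-module is a Mathlib `CStarModule` over the opposite algebra `Cᵐᵒᵖ`:
`MulOpposite.op c • x` is `x c`, and `cInner C x y` is the `C`-valued inner product
`⟨x, y⟩`, conjugate linear in `x`, with `⟨x, y c⟩ = ⟨x, y⟩ c` and `‖x‖² = ‖⟨x, x⟩‖`. -/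

section HilbertModule

variable {C : Type*} [CStarAlgebra C] [PartialOrder C]
variable {E : Type*} [NormedAddCommGroup E] [NormedSpace ℂ E] [Module Cᵐᵒᵖ E] [CStarModule Cᵐᵒᵖ E]

variable (C) in
/-- The `C`-valued inner product `⟨x, y⟩` of a right Hilbert `C`-module. -/
def cInner (x y : E) : C := MulOpposite.unop (inner Cᵐᵒᵖ x y)

lemma cInner_add_right (x y z : E) : cInner C x (y + z) = cInner C x y + cInner C x z := by
  simp [cInner]

lemma cInner_add_left (x y z : E) : cInner C (x + y) z = cInner C x z + cInner C y z := by
  simp [cInner]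

lemma cInner_smul_right (a : ℂ) (x y : E) : cInner C x (a • y) = a • cInner C x y := by
  simp [cInner]

lemma cInner_smul_left (a : ℂ) (x y : E) : cInner C (a • x) y = star a • cInner C x y := by
  simp [cInner]

lemma cInner_op_smul_right (c : C) (x y : E) :
    cInner C x (MulOpposite.op c • y) = cInner C x y * c := by
  simp [cInner]

lemma cInner_op_smul_left (c : C) (x y : E) :
    cInner C (MulOpposite.op c • x) y = star c * cInner C x y := by
  simp [cInner]

lemma star_cInner (x y : E) : star (cInner C x y) = cInner C y x := by
  simp [cInner, ← MulOpposite.unop_star]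

lemma cInner_self_nonneg (x : E) : 0 ≤ cInner C x x :=
  CStarModule.inner_self_nonneg (A := Cᵐᵒᵖ) (x := x)

lemma cInner_sum_right {ι : Type*} (s : Finset ι) (x : E) (y : ι → E) :
    cInner C x (∑ i ∈ s, y i) = ∑ i ∈ s, cInner C x (y i) := by
  simp [cInner]

lemma cInner_sum_left {ι : Type*} (s : Finset ι) (x : ι → E) (y : E) :
    cInner C (∑ i ∈ s, x i) y = ∑ i ∈ s, cInner C (x i) y := by
  simp [cInner]

lemma norm_sq_eq_cInner (x : E) : ‖x‖ ^ 2 = ‖cInner C x x‖ :=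
  CStarModule.norm_sq_eq Cᵐᵒᵖ (x := x)

end HilbertModule

/-! Positivity of Gram matrices, needed for the interior tensor product. -/

lemma IsSelfAdjoint.exists_conj_eq_neg {A : Type*} [CStarAlgebra A] {G : A}
    (hG : IsSelfAdjoint G) :
    ∃ P D : A, star P * G * P = -(star D * D) ∧ (D = 0 → ∃ R : A, G = star R * R) := by
  let _ : PartialOrder A := CStarAlgebra.spectralOrder A
  have : StarOrderedRing A := CStarAlgebra.spectralOrderedRing A
  have hP : 0 ≤ G⁻ := CFC.negPart_nonneg G
  have hPs : star G⁻ = G⁻ := hP.isSelfAdjoint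
  obtain ⟨s, hs, hss⟩ := CStarAlgebra.nonneg_iff_exists_isSelfAdjoint_and_eq_mul_self.mp hP
  refine ⟨G⁻, s * G⁻, ?_, fun hD => ?_⟩
  · have h1 : G⁻ * G * G⁻ = -(G⁻ * G⁻ * G⁻) := by
      have h2 : G⁻ * (G⁺ - G⁻) * G⁻ = -(G⁻ * G⁻ * G⁻) := by simp [mul_sub]
      rwa [CFC.posPart_sub_negPart G hG] at h2
    rw [star_mul, hPs, hs.star_eq, h1]
    congr 1
    calc G⁻ * G⁻ * G⁻ = G⁻ * (s * s) * G⁻ := by rw [← hss]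
      _ = _ := by simp only [mul_assoc]
  · have hN : G⁻ = 0 := by
      have : star G⁻ * G⁻ = 0 := by
        rw [hPs]
        calc G⁻ * G⁻ = (s * s) * G⁻ := by rw [← hss]
          _ = 0 := by rw [mul_assoc, hD, mul_zero]
      exact (CStarRing.star_mul_self_eq_zero_iff _).mp this
    rw [← CStarAlgebra.nonneg_iff_eq_star_mul_self, ← CFC.posPart_sub_negPart G hG, hN, sub_zero]
    exact CFC.posPart_nonneg G

lemma exists_gram_factorization {C E : Type*} [CStarAlgebra C] [PartialOrder C]
    [StarOrderedRing C] [NormedAddCommGroup E] [NormedSpace ℂ E] [Module Cᵐᵒᵖ E]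
    [CStarModule Cᵐᵒᵖ E] {ι : Type*} [Fintype ι] (x : ι → E) :
    ∃ R : ι → ι → C, ∀ i j, cInner C (x i) (x j) = ∑ k, star (R k i) * R k j := by
  classical
  let G : CStarMatrix ι ι C := CStarMatrix.ofMatrix fun i j => cInner C (x i) (x j)
  have hGa (i j) : G i j = cInner C (x i) (x j) := rfl
  have hG : IsSelfAdjoint G := by
    ext i j
    rw [CStarMatrix.star_apply, hGa, hGa, star_cInner]
  have hconj (M : CStarMatrix ι ι C) (k : ι) : 0 ≤ (star M * G * M) k k := by
    have : (star M * G * M) k k = cInner C (∑ i, MulOpposite.op (M i k) • x i)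
        (∑ i, MulOpposite.op (M i k) • x i) := by
      simp only [cInner_sum_right, cInner_sum_left, cInner_op_smul_right, cInner_op_smul_left,
        CStarMatrix.mul_apply, CStarMatrix.star_apply, hGa, Finset.sum_mul]
    rw [this]
    exact cInner_self_nonneg _
  obtain ⟨P, D, hPD, hD0⟩ := hG.exists_conj_eq_neg
  have hD : D = 0 := by
    have key (k : ι) : ∑ i, star (D i k) * D i k = 0 := by
      have h1 := hconj P k
      have h2 : (star D * D) k k = ∑ i, star (D i k) * D i k := by
        simp only [CStarMatrix.mul_apply, CStarMatrix.star_apply]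
      rw [hPD, CStarMatrix.neg_apply, h2] at h1
      exact le_antisymm (neg_nonneg.mp h1) (Finset.sum_nonneg fun i _ => star_mul_self_nonneg _)
    ext i k
    have := (Finset.sum_eq_zero_iff_of_nonneg fun i _ => star_mul_self_nonneg (D i k)).mp (key k) i
      (Finset.mem_univ _)
    exact (CStarRing.star_mul_self_eq_zero_iff _).mp this
  obtain ⟨R, hR⟩ := hD0 hD
  refine ⟨fun i j => R i j, fun i j => ?_⟩
  rw [← hGa, hR]
  simp only [CStarMatrix.mul_apply, CStarMatrix.star_apply]

/-! ## The interior tensor product `E ⊗ H` and von Neumann modules -/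

section InteriorTensor

open TensorProduct

variable {H : Type*} [NormedAddCommGroup H] [InnerProductSpace ℂ H] [CompleteSpace H]
variable (C : VonNeumannAlgebra H)
variable (E : Type*) [NormedAddCommGroup E] [NormedSpace ℂ E] [Module Cᵐᵒᵖ E] [CStarModule Cᵐᵒᵖ E]

variable {E} in
/-- The functional `y ⊗ k ↦ ⟨h, ⟨x, y⟩ k⟩` on the algebraic tensor product. -/
noncomputable def interiorFunctional (x : E) (h : H) : E ⊗[ℂ] H →ₗ[ℂ] ℂ :=
  TensorProduct.lift <| LinearMap.mk₂ ℂ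
    (fun (y : E) (k : H) => inner ℂ h ((cInner C x y : H →L[ℂ] H) k))
    (fun y y' k => by simp [cInner_add_right])
    (fun a y k => by simp [cInner_smul_right])
    (fun y k k' => by simp)
    (fun a y k => by simp)

/-- The sesquilinear form `⟨x ⊗ h, y ⊗ k⟩ = ⟨h, ⟨x, y⟩ k⟩` on the algebraic tensor product. -/
noncomputable def interiorForm : E ⊗[ℂ] H →ₗ⋆[ℂ] E ⊗[ℂ] H →ₗ[ℂ] ℂ :=
  TensorProduct.lift <| LinearMap.mk₂'ₛₗ (starRingEnd ℂ) (starRingEnd ℂ)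
    (fun (x : E) (h : H) => interiorFunctional C x h)
    (fun x x' h => by ext y k; simp [interiorFunctional, cInner_add_left])
    (fun a x h => by ext y k; simp [interiorFunctional, cInner_smul_left])
    (fun x h h' => by ext y k; simp [interiorFunctional])
    (fun a x h => by ext y k; simp [interiorFunctional, mul_comm])

lemma interiorForm_tmul (x y : E) (h k : H) :
    interiorForm C E (x ⊗ₜ h) (y ⊗ₜ k) = inner ℂ h ((cInner C x y : H →L[ℂ] H) k) := by
  simp [interiorForm, interiorFunctional]

lemma interiorForm_symm (t u : E ⊗[ℂ] H) :
    starRingEnd ℂ (interiorForm C E u t) = interiorForm C E t u := by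
  induction t with
  | zero => simp
  | add t t' ht ht' => simp [ht, ht']
  | tmul x h =>
    induction u with
    | zero => simp
    | add u u' hu hu' => simp [hu, hu']
    | tmul y k =>
      rw [interiorForm_tmul, interiorForm_tmul, inner_conj_symm, ← star_cInner (C := C) y x,
        StarMemClass.coe_star, ContinuousLinearMap.star_eq_adjoint,
        ContinuousLinearMap.adjoint_inner_right]

lemma interiorForm_self_nonneg (t : E ⊗[ℂ] H) : 0 ≤ RCLike.re (interiorForm C E t t) := by
  obtain ⟨S, rfl⟩ := TensorProduct.exists_finset t
  obtain ⟨R, hR⟩ := exists_gram_factorization (C := C) (fun i : S => i.1.1)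
  have hR' (i j : S) (h k : H) : inner ℂ h ((cInner C i.1.1 j.1.1 : H →L[ℂ] H) k)
      = ∑ l : S, inner ℂ ((R l i : H →L[ℂ] H) h) ((R l j : H →L[ℂ] H) k) := by
    rw [hR i j]
    simp only [AddSubmonoidClass.coe_finsetSum, MulMemClass.coe_mul, StarMemClass.coe_star,
      sum_apply, mul_apply_eq_comp, inner_sum,
      ContinuousLinearMap.star_eq_adjoint, ContinuousLinearMap.adjoint_inner_right]
  have : interiorForm C E (∑ i ∈ S, i.1 ⊗ₜ i.2) (∑ i ∈ S, i.1 ⊗ₜ i.2)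
      = ∑ l : S, inner ℂ (∑ i : S, (R l i : H →L[ℂ] H) i.1.2)
          (∑ i : S, (R l i : H →L[ℂ] H) i.1.2) := by
    rw [← Finset.sum_coe_sort]
    simp only [map_sum, LinearMap.sum_apply, interiorForm_tmul, hR', sum_inner, inner_sum]
    rw [Finset.sum_comm (f := fun l j => ∑ i : S, inner ℂ ((R l i : H →L[ℂ] H) i.1.2)
      ((R l j : H →L[ℂ] H) j.1.2))]
    exact Finset.sum_congr rfl fun j _ => Finset.sum_comm
  rw [this, map_sum]
  exact Finset.sum_nonneg fun k _ => inner_self_nonneg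

set_option linter.unusedVariables false in
/-- The algebraic tensor product, to be given the seminorm of `interiorForm`. -/
@[nolint unusedArguments]
def PreInteriorTensor (C : VonNeumannAlgebra H) (E : Type*) [NormedAddCommGroup E]
    [NormedSpace ℂ E] [Module Cᵐᵒᵖ E] [CStarModule Cᵐᵒᵖ E] : Type _ := E ⊗[ℂ] H

noncomputable instance : AddCommGroup (PreInteriorTensor C E) :=
  inferInstanceAs (AddCommGroup (E ⊗[ℂ] H))

noncomputable instance : Module ℂ (PreInteriorTensor C E) :=
  inferInstanceAs (Module ℂ (E ⊗[ℂ] H))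

/-- The identity map from the algebraic tensor product. -/
noncomputable def toPreInteriorTensor : E ⊗[ℂ] H ≃ₗ[ℂ] PreInteriorTensor C E :=
  LinearEquiv.refl ℂ _

noncomputable abbrev interiorCore : PreInnerProductSpace.Core ℂ (PreInteriorTensor C E) where
  inner t u := interiorForm C E ((toPreInteriorTensor C E).symm t)
    ((toPreInteriorTensor C E).symm u)
  conj_inner_symm t u := interiorForm_symm C E _ _
  re_inner_nonneg t := interiorForm_self_nonneg C E _
  add_left t u v := by simp
  smul_left t u a := by simp

noncomputable instance : SeminormedAddCommGroup (PreInteriorTensor C E) :=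
  InnerProductSpace.Core.toSeminormedAddCommGroup (c := interiorCore C E)

noncomputable instance : InnerProductSpace ℂ (PreInteriorTensor C E) :=
  InnerProductSpace.ofCore (interiorCore C E)

/-- The interior tensor product `E ⊗ H`: the Hilbert space obtained from the algebraic tensor
product with `⟨x ⊗ h, y ⊗ k⟩ = ⟨h, ⟨x, y⟩ k⟩` by separation and completion. -/
abbrev InteriorTensor : Type _ := UniformSpace.Completion (PreInteriorTensor C E)

variable {E}

/-- The elementary tensor `x ⊗ h` in the interior tensor product. -/
noncomputable def interiorTmul (x : E) (h : H) : InteriorTensor C E :=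
  (toPreInteriorTensor C E (x ⊗ₜ[ℂ] h) : PreInteriorTensor C E)

lemma inner_interiorTmul (x y : E) (h k : H) :
    inner ℂ (interiorTmul C x h) (interiorTmul C y k)
      = inner ℂ h ((cInner C x y : H →L[ℂ] H) k) := by
  rw [interiorTmul, interiorTmul, UniformSpace.Completion.inner_coe]
  exact interiorForm_tmul C E x y h k

lemma norm_interiorTmul_le (x : E) (h : H) : ‖interiorTmul C x h‖ ≤ ‖x‖ * ‖h‖ := by
  refine (sq_le_sq₀ (norm_nonneg _) (by positivity)).mp ?_
  have h1 : ‖interiorTmul C x h‖ ^ 2 = ‖inner ℂ h ((cInner C x x : H →L[ℂ] H) h)‖ := by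
    rw [← inner_interiorTmul, inner_self_eq_norm_sq_to_K]
    simp
  have h2 : ‖x‖ ^ 2 = ‖(cInner C x x : H →L[ℂ] H)‖ := norm_sq_eq_cInner (C := C) x
  calc ‖interiorTmul C x h‖ ^ 2 ≤ ‖h‖ * (‖(cInner C x x : H →L[ℂ] H)‖ * ‖h‖) := by
        rw [h1]
        exact (norm_inner_le_norm _ _).trans
          (mul_le_mul_of_nonneg_left (ContinuousLinearMap.le_opNorm _ _) (norm_nonneg _))
    _ = (‖x‖ * ‖h‖) ^ 2 := by rw [← h2]; ring

/-- The operator `L_x : H → E ⊗ H`, `h ↦ x ⊗ h`. -/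
noncomputable def interiorL (x : E) : H →L[ℂ] InteriorTensor C E :=
  LinearMap.mkContinuous
    { toFun := interiorTmul C x
      map_add' := fun h h' => by
        rw [interiorTmul, interiorTmul, interiorTmul, ← UniformSpace.Completion.coe_add,
          TensorProduct.tmul_add, map_add]
      map_smul' := fun a h => by
        rw [interiorTmul, interiorTmul, RingHom.id_apply, ← UniformSpace.Completion.coe_smul,
          TensorProduct.tmul_smul, map_smul] } ‖x‖ (norm_interiorTmul_le C x)

variable (E) in
/-- A Hilbert `C`-module `E` over a von Neumann algebra `C` on `H` is a von Neumann `C`-module if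
`{L_x | x ∈ E}` is closed in `B(H, E ⊗ H)` in the strong operator topology (the topology of
pointwise convergence). -/
def IsVonNeumannModule : Prop :=
  IsClosed (Set.range fun x : E =>
    ContinuousLinearMap.toPointwiseConvergenceCLM ℂ (RingHom.id ℂ) H (InteriorTensor C E)
      (interiorL C x))

end InteriorTensor

/-! ## Kernels, S-correspondences, Kolmogorov decompositions and the Bures distance -/

universe u v w

/-- `α`-completely positive definite kernels over `Ω` from `B` to `C`. -/
structure IsAlphaCPD {B C Ω : Type*} [CStarAlgebra B] [CStarAlgebra C] [PartialOrder C]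
    (α : B ≃⋆ₐ[ℂ] B) (K : Ω → Ω → B →L[ℂ] C) : Prop where
  hermitian : ∀ (σ τ : Ω) (b : B), K σ τ (star b) = star (K τ σ b)
  nonneg : ∀ (n : ℕ) (σ : Fin n → Ω) (b : Fin n → B) (c : Fin n → C),
    0 ≤ ∑ i, ∑ j, star (c i) * K (σ i) (σ j) (star (α (b i)) * b j) * c j
  invariant : ∀ (σ τ : Ω) (b : B), K σ τ (α b) = K σ τ b
  bounded : ∀ b : B, ∃ M : ℝ, 0 < M ∧
    ∀ (n : ℕ) (σ : Fin n → Ω) (d : Fin n → B) (c : Fin n → C),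
      ‖∑ i, ∑ j, star (c i) * K (σ i) (σ j) (α (star (d i) * star b) * b * d j) * c j‖ ≤
        M * ‖∑ i, ∑ j, star (c i) * K (σ i) (σ j) (α (star (d i)) * d j) * c j‖

/-- An S-correspondence from `B` to `C`: a Hilbert `C`-module with a unitary `U` and a
`U`-representation `π` of `B`, that is, a unital algebra homomorphism `π` into the adjointable
operators with `[π(b) x, y] = [x, π(b*) y]` for the form `[x, y] = ⟨x, U y⟩`. -/
structure SCorrespondence (B : Type u) (C : Type v) [CStarAlgebra B] [CStarAlgebra C]
    [PartialOrder C] where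
  carrier : Type w
  [normedAddCommGroup : NormedAddCommGroup carrier]
  [normedSpace : NormedSpace ℂ carrier]
  [module : Module Cᵐᵒᵖ carrier]
  [cstarModule : CStarModule Cᵐᵒᵖ carrier]
  [completeSpace : CompleteSpace carrier]
  U : carrier ≃ₗ[ℂ] carrier
  /-- `U` is adjointable with `U* = U⁻¹`. -/
  cInner_U_left : ∀ x y : carrier, cInner C (U x) y = cInner C x (U.symm y)
  π : B →ₐ[ℂ] Module.End ℂ carrier
  /-- `π b` is adjointable. -/
  π_adjointable : ∀ b : B, ∃ T : carrier → carrier,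
    ∀ x y : carrier, cInner C (π b x) y = cInner C x (T y)
  π_natural : ∀ (b : B) (x y : carrier),
    cInner C (π b x) (U y) = cInner C x (U (π (star b) y))

namespace SCorrespondence

attribute [instance] normedAddCommGroup normedSpace module cstarModule completeSpace

section General

variable {B : Type u} {C : Type v} [CStarAlgebra B] [CStarAlgebra C] [PartialOrder C]

/-- `(F, U, i)` decomposes the kernel `K`:
`K^{σ,τ}(b) = ⟨i σ, b i τ⟩ = ⟨α(b*) i σ, i τ⟩`, and `U` implements `α` on the vectors
`b i(σ) c`, that is, `U (b i(σ) c) = α(b) i(σ) c`. -/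
structure Decomposes (F : SCorrespondence.{u, v, w} B C) (α : B ≃⋆ₐ[ℂ] B) {Ω : Type*}
    (K : Ω → Ω → B →L[ℂ] C) (i : Ω → F.carrier) : Prop where
  kernel_eq : ∀ (σ τ : Ω) (b : B), K σ τ b = cInner C (i σ) (F.π b (i τ))
  kernel_eq' : ∀ (σ τ : Ω) (b : B), K σ τ b = cInner C (F.π (α (star b)) (i σ)) (i τ)
  U_apply : ∀ (b : B) (σ : Ω) (c : C),
    F.U (MulOpposite.op c • F.π b (i σ)) = MulOpposite.op c • F.π (α b) (i σ)

/-- The set `S(F, K)` of all maps `i : Ω → F` through which `F` decomposes `K`. -/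
def S (F : SCorrespondence.{u, v, w} B C) (α : B ≃⋆ₐ[ℂ] B) {Ω : Type*}
    (K : Ω → Ω → B →L[ℂ] C) : Set (Ω → F.carrier) :=
  {i | F.Decomposes α K i}

/-- `F` is a common S-correspondence for `K₁` and `K₂`. -/
def IsCommon (F : SCorrespondence.{u, v, w} B C) (α : B ≃⋆ₐ[ℂ] B) {Ω : Type*}
    (K₁ K₂ : Ω → Ω → B →L[ℂ] C) : Prop :=
  (F.S α K₁).Nonempty ∧ (F.S α K₂).Nonempty

/-- `β_F(K₁, K₂) = inf {‖i₁ σ - i₂ σ‖ : i₁ ∈ S(F, K₁), i₂ ∈ S(F, K₂), σ ∈ Ω}`. -/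
noncomputable def buresDistOn (F : SCorrespondence.{u, v, w} B C) (α : B ≃⋆ₐ[ℂ] B) {Ω : Type*}
    (K₁ K₂ : Ω → Ω → B →L[ℂ] C) : ℝ :=
  sInf {r : ℝ | ∃ i₁ ∈ F.S α K₁, ∃ i₂ ∈ F.S α K₂, ∃ σ : Ω, r = ‖i₁ σ - i₂ σ‖}

end General

section Sum

open scoped InnerProductSpace
open WithCStarModule

variable {B : Type u} {C : Type v} [CStarAlgebra B] [CStarAlgebra C] [PartialOrder C]
  [StarOrderedRing C]

/-- The direct sum of two Hilbert `C`-modules, with `⟨x, y⟩ = ⟨x₁, y₁⟩ + ⟨x₂, y₂⟩`. -/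
abbrev SumCarrier (F₁ F₂ : SCorrespondence.{u, v, w} B C) : Type w :=
  WithCStarModule Cᵐᵒᵖ (F₁.carrier × F₂.carrier)

/-- The vector `x ⊕ y` of the direct sum. -/
def sumMk (F₁ F₂ : SCorrespondence.{u, v, w} B C) (x : F₁.carrier) (y : F₂.carrier) :
    SumCarrier F₁ F₂ :=
  (WithCStarModule.equiv Cᵐᵒᵖ (F₁.carrier × F₂.carrier)).symm (x, y)

lemma cInner_sum (F₁ F₂ : SCorrespondence.{u, v, w} B C) (x y : SumCarrier F₁ F₂) :
    cInner C x y = cInner C x.1 y.1 + cInner C x.2 y.2 := rfl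

/-- The direct sum `F₁ ⊕ F₂` with `U = U₁ ⊕ U₂` and `π = π₁ ⊕ π₂`. -/
noncomputable def directSum (F₁ F₂ : SCorrespondence.{u, v, w} B C) : SCorrespondence.{u, v, w} B C where
  carrier := SumCarrier F₁ F₂
  U := ((WithCStarModule.linearEquiv ℂ Cᵐᵒᵖ (F₁.carrier × F₂.carrier)).trans
    (F₁.U.prodCongr F₂.U)).trans
      (WithCStarModule.linearEquiv ℂ Cᵐᵒᵖ (F₁.carrier × F₂.carrier)).symm
  cInner_U_left x y := by
    exact congrArg₂ (· + ·) (F₁.cInner_U_left x.1 y.1) (F₂.cInner_U_left x.2 y.2)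
  π :=
    { toFun := fun b =>
        { toFun := fun x => sumMk F₁ F₂ (F₁.π b x.1) (F₂.π b x.2)
          map_add' := fun x y => Prod.ext (map_add (F₁.π b) x.1 y.1) (map_add (F₂.π b) x.2 y.2)
          map_smul' := fun a x =>
            Prod.ext (map_smul (F₁.π b) a x.1) (map_smul (F₂.π b) a x.2) }
      map_one' := LinearMap.ext fun x => Prod.ext
        (LinearMap.congr_fun (map_one F₁.π) x.1) (LinearMap.congr_fun (map_one F₂.π) x.2)
      map_mul' := fun b d => LinearMap.ext fun x => Prod.ext
        (LinearMap.congr_fun (map_mul F₁.π b d) x.1) (LinearMap.congr_fun (map_mul F₂.π b d) x.2)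
      map_zero' := LinearMap.ext fun x => Prod.ext
        (LinearMap.congr_fun (map_zero F₁.π) x.1) (LinearMap.congr_fun (map_zero F₂.π) x.2)
      map_add' := fun b d => LinearMap.ext fun x => Prod.ext
        (LinearMap.congr_fun (map_add F₁.π b d) x.1) (LinearMap.congr_fun (map_add F₂.π b d) x.2)
      commutes' := fun a => LinearMap.ext fun x => Prod.ext
        (LinearMap.congr_fun (F₁.π.commutes a) x.1) (LinearMap.congr_fun (F₂.π.commutes a) x.2) }
  π_adjointable b := by
    obtain ⟨T₁, hT₁⟩ := F₁.π_adjointable b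
    obtain ⟨T₂, hT₂⟩ := F₂.π_adjointable b
    exact ⟨fun y => sumMk F₁ F₂ (T₁ y.1) (T₂ y.2), fun x y =>
      congrArg₂ (· + ·) (hT₁ x.1 y.1) (hT₂ x.2 y.2)⟩
  π_natural b x y := by
    exact congrArg₂ (· + ·) (F₁.π_natural b x.1 y.1) (F₂.π_natural b x.2 y.2)

/-- The vector `x ⊕ y` of `F₁ ⊕ F₂`. -/
def directSumMk (F₁ F₂ : SCorrespondence.{u, v, w} B C) (x : F₁.carrier) (y : F₂.carrier) :
    (F₁.directSum F₂).carrier :=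
  sumMk F₁ F₂ x y

lemma directSum_U_apply (F₁ F₂ : SCorrespondence.{u, v, w} B C) (x : F₁.carrier)
    (y : F₂.carrier) :
    (F₁.directSum F₂).U (directSumMk F₁ F₂ x y) = directSumMk F₁ F₂ (F₁.U x) (F₂.U y) := rfl

lemma directSum_π_apply (F₁ F₂ : SCorrespondence.{u, v, w} B C) (b : B) (x : F₁.carrier)
    (y : F₂.carrier) :
    (F₁.directSum F₂).π b (directSumMk F₁ F₂ x y) =
      directSumMk F₁ F₂ (F₁.π b x) (F₂.π b y) := rfl

end Sum

end SCorrespondence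

/-- The Bures distance `β(K₁, K₂)`: the infimum of `β_F(K₁, K₂)` over all common
S-correspondences `F` for `K₁` and `K₂`. -/
noncomputable def buresDist {B : Type u} {C : Type v} [CStarAlgebra B] [CStarAlgebra C]
    [PartialOrder C] (α : B ≃⋆ₐ[ℂ] B) {Ω : Type*} (K₁ K₂ : Ω → Ω → B →L[ℂ] C) : ℝ :=
  sInf {r : ℝ | ∃ F : SCorrespondence.{u, v, w} B C, F.IsCommon α K₁ K₂ ∧
    r = F.buresDistOn α K₁ K₂}

/-- `(F, U, i)` is a Kolmogorov decomposition of the kernel `K` with values in the von Neumann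
algebra `C` on `H`: `F` is a von Neumann `C`-module and decomposes `K`. -/
structure IsKolmogorovDecomposition {B : Type u} [CStarAlgebra B]
    {H : Type v} [NormedAddCommGroup H] [InnerProductSpace ℂ H] [CompleteSpace H]
    (C : VonNeumannAlgebra H) (α : B ≃⋆ₐ[ℂ] B) {Ω : Type*} (K : Ω → Ω → B →L[ℂ] C)
    (F : SCorrespondence.{u, v, w} B C) (i : Ω → F.carrier) : Prop where
  isVonNeumannModule : IsVonNeumannModule C F.carrier
  decomposes : F.Decomposes α K i

/-! For decompositions `j₁`, `j₂` of `K₁`, `K₂` in a common `F`, expanding `⟨j₁ σ - j₂ σ, j₁ σ - j₂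
σ⟩` gives `K₁ σ σ 1`, `K₂ σ σ 1` and the cross term `⟨j₁ σ, j₂ σ⟩` with its adjoint. Only the cross
term depends on the decompositions, so it suffices to reproduce every cross term in `F₁ ⊕ F₂` with
`i₁ ⊕ 0` as first vector. Every distance that occurs in some `F` then occurs in the last set of the
theorem, and all three infima agree.

The work takes place in the Hilbert spaces `F ⊗ H`, so that `F` itself need not be a von Neumann
module. The Gram matrix of the vectors `b i(σ) ⊗ h` depends only on the kernel and `α`
(`Decomposes.inner_cyclicVector`). Hence there are partial isometries `V₁`, `V₂` from `F₁ ⊗ H`, `F₂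
⊗ H` to `F ⊗ H` matching these vectors, and the contraction `T = V₁* V₂` carries the cross term
(`exists_contraction_of_inner_eq`). With `D = (1 - T* T)^{1/2}` the column `(T, D)` is an isometry,
so `T i₂ ⊕ D i₂` again decomposes `K₂`, and its inner product with `i₁ ⊕ 0` is the prescribed cross
term.

It remains to see that `T i₂(σ)` and `D i₂(σ)` are vectors of the modules. `T` and `D` intertwine
the operators `1 ⊗ s` with `s` in the commutant of `C`, and a double commutant argument
(`IsVonNeumannModule.exists_interiorL_eq`) shows that in a von Neumann module every such intertwiner
`H → E ⊗ H` is some `L_x`. `T` and `D` also intertwine the left actions and the unitaries, since on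
the vectors `b i(σ) ⊗ h` these operators and their adjoints only change the index. -/

/-! ### Hilbert space operators: a growth bound and partial isometries from Gram matrices -/

section HilbertSpace

open InnerProductSpace ContinuousLinearMap

/-- If `‖Sⁿ t‖ ≤ c Mⁿ` for all `n`, where `S = A* A`, then `‖A t‖² ≤ M ‖t‖²`. -/
lemma norm_sq_le_of_pow_adjoint_mul_self_le {V W : Type*} [SeminormedAddCommGroup V]
    [InnerProductSpace ℂ V] [SeminormedAddCommGroup W] [InnerProductSpace ℂ W]
    (A : V →ₗ[ℂ] W) (A' : W →ₗ[ℂ] V)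
    (hA : ∀ t u, inner ℂ (A t) u = inner ℂ t (A' u)) {M : ℝ} (hM : 0 ≤ M)
    (t : V) {c : ℝ} (hc : ∀ n : ℕ, ‖((A' ∘ₗ A) ^ n) t‖ ≤ c * M ^ n) :
    ‖A t‖ ^ 2 ≤ M * ‖t‖ ^ 2 := by
  set S := A' ∘ₗ A with hS
  set a : ℕ → ℝ := fun n => ‖(S ^ n) t‖ with ha
  have hsym (x y : V) : inner ℂ (S x) y = inner ℂ x (S y) := by
    have h := hA y (A x)
    rw [← inner_conj_symm, ← inner_conj_symm (𝕜 := ℂ) y] at h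
    have h' := (starRingEnd ℂ).injective h
    simp only [hS, LinearMap.comp_apply]
    rw [← h', hA]
  -- By Cauchy-Schwarz `n ↦ ‖Sⁿ t‖` is log-convex, so its successive ratios never decrease. If the
  -- first ratio `r` exceeded `M`, the sequence would outgrow `c Mⁿ`. No boundedness of `A` is
  -- needed.
  have hlog (n : ℕ) : a (n + 1) ^ 2 ≤ a n * a (n + 2) := by
    have h1 : inner ℂ ((S ^ (n + 1)) t) ((S ^ (n + 1)) t)
        = inner ℂ ((S ^ n) t) ((S ^ (n + 2)) t) := by
      rw [pow_succ' S n, pow_succ' S (n + 1), Module.End.mul_apply, hsym, pow_succ' S n]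
      rfl
    have h2 := norm_inner_le_norm (𝕜 := ℂ) ((S ^ n) t) ((S ^ (n + 2)) t)
    rw [← h1, inner_self_eq_norm_sq_to_K] at h2
    simpa using h2
  have ha0 (n : ℕ) : 0 ≤ a n := norm_nonneg _
  have hA2 : ‖A t‖ ^ 2 ≤ a 0 * a 1 := by
    have h2 := norm_inner_le_norm (𝕜 := ℂ) t (S t)
    have h1 : inner ℂ t (S t) = inner ℂ (A t) (A t) := (hA _ _).symm
    rw [h1, inner_self_eq_norm_sq_to_K] at h2
    simpa [ha] using h2
  suffices h : a 1 ≤ M * a 0 by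
    calc ‖A t‖ ^ 2 ≤ a 0 * (M * a 0) := hA2.trans (mul_le_mul_of_nonneg_left h (ha0 0))
      _ = M * ‖t‖ ^ 2 := by simp [ha]; ring
  by_contra! hlt
  have ha0pos : 0 < a 0 := by
    refine (ha0 0).lt_of_ne fun h0 => ?_
    have h1 := hlog 0
    rw [← h0] at h1
    have : a 1 = 0 := by nlinarith
    rw [this, ← h0] at hlt
    simp at hlt
  set r := a 1 / a 0 with hr
  have hrM : M < r := by rwa [hr, lt_div_iff₀ ha0pos]
  have hrpos : 0 < r := hM.trans_lt hrM
  have hstep (n : ℕ) : 0 < a n ∧ r * a n ≤ a (n + 1) := by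
    induction n with
    | zero => exact ⟨ha0pos, by rw [hr, div_mul_cancel₀ _ ha0pos.ne']⟩
    | succ n ih =>
      have hpos : 0 < a (n + 1) := (mul_pos hrpos ih.1).trans_le ih.2
      refine ⟨hpos, ?_⟩
      have h1 := hlog n
      have h2 : a n * (r * a (n + 1)) ≤ a n * a (n + 2) := by nlinarith
      exact le_of_mul_le_mul_left h2 ih.1
  have hgrow (n : ℕ) : a 0 * r ^ n ≤ a n := by
    induction n with
    | zero => simp
    | succ n ih =>
      calc a 0 * r ^ (n + 1) = r * (a 0 * r ^ n) := by ring
        _ ≤ r * a n := mul_le_mul_of_nonneg_left ih hrpos.le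
        _ ≤ a (n + 1) := (hstep n).2
  have hq (n : ℕ) : a 0 * r ^ n ≤ c * M ^ n := (hgrow n).trans (hc n)
  have hlim : Filter.Tendsto (fun n : ℕ => c * (M / r) ^ n) Filter.atTop (nhds (c * 0)) :=
    (tendsto_pow_atTop_nhds_zero_of_lt_one (div_nonneg hM hrpos.le)
      ((div_lt_one hrpos).mpr hrM)).const_mul c
  have hge : a 0 ≤ c * 0 := ge_of_tendsto' hlim fun n => by
    rw [div_pow, ← mul_div_assoc, le_div_iff₀ (pow_pos hrpos n)]
    exact hq n
  linarith

variable {K₁ K : Type*} [NormedAddCommGroup K₁] [InnerProductSpace ℂ K₁] [CompleteSpace K₁]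
  [NormedAddCommGroup K] [InnerProductSpace ℂ K] [CompleteSpace K]

/-- Families with the same Gram matrix are related by a partial isometry, which intertwines all
operators that act on both families by the same map of indices. -/
lemma exists_partialIsometry_of_inner_eq {ι : Type*} (u : ι → K₁) (v : ι → K)
    (huv : ∀ a b, inner ℂ (u a) (u b) = inner ℂ (v a) (v b)) :
    ∃ V : K₁ →L[ℂ] K, ‖V‖ ≤ 1 ∧ (∀ a, V (u a) = v a) ∧
      ∀ (X₁ : K₁ →L[ℂ] K₁) (X : K →L[ℂ] K) (f g : ι → ι),
        (∀ a, X₁ (u a) = u (f a)) → (∀ a, X (v a) = v (f a)) →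
        (∀ a, (adjoint X₁) (u a) = u (g a)) → V ∘L X₁ = X ∘L V := by
  classical
  let lu : (ι →₀ ℂ) →ₗ[ℂ] K₁ := Finsupp.linearCombination ℂ u
  let lv : (ι →₀ ℂ) →ₗ[ℂ] K := Finsupp.linearCombination ℂ v
  have hin (c : ι →₀ ℂ) : inner ℂ (lu c) (lu c) = inner ℂ (lv c) (lv c) := by
    simp only [lu, lv, Finsupp.linearCombination_apply, Finsupp.sum, sum_inner, inner_sum,
      inner_smul_left, inner_smul_right, huv]
  have hnorm (c : ι →₀ ℂ) : ‖lv c‖ = ‖lu c‖ := by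
    rw [@norm_eq_sqrt_re_inner ℂ, @norm_eq_sqrt_re_inner ℂ, hin]
  let G : Submodule ℂ K₁ := (LinearMap.range lu).topologicalClosure
  have hmemG (c : ι →₀ ℂ) : lu c ∈ G := Submodule.le_topologicalClosure _ ⟨c, rfl⟩
  have : CompleteSpace G := (Submodule.isClosed_topologicalClosure _).completeSpace_coe
  let e : (ι →₀ ℂ) →ₗ[ℂ] G := lu.codRestrict G hmemG
  have hdense : DenseRange e := by
    intro x
    rw [Metric.mem_closure_iff]
    intro ε hε
    obtain ⟨y, ⟨c, rfl⟩, hy⟩ := Metric.mem_closure_iff.mp x.2 ε hε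
    exact ⟨e c, ⟨c, rfl⟩, hy⟩
  have hbd (c : ι →₀ ℂ) : ‖lv c‖ ≤ 1 * ‖e c‖ := by
    rw [one_mul, hnorm]
    rfl
  let V₀ : G →L[ℂ] K := lv.extendOfNorm e
  have hV₀ (c : ι →₀ ℂ) : V₀ (e c) = lv c := LinearMap.extendOfNorm_eq hdense ⟨1, hbd⟩ c
  -- The isometry `u a ↦ v a` on the closed span `G` of the family `u`, extended by zero to `Gᗮ`.
  let V : K₁ →L[ℂ] K := V₀ ∘L G.orthogonalProjectionOnto
  have hVlu (c : ι →₀ ℂ) : V (lu c) = lv c := by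
    rw [← hV₀]
    exact congrArg V₀ (G.orthogonalProjectionOnto_mem_subspace_eq_self (e c))
  have hVu (a : ι) : V (u a) = v a := by
    simpa [lu, lv] using hVlu (Finsupp.single a 1)
  have hVperp {z : K₁} (hz : ∀ a, inner ℂ (u a) z = 0) : V z = 0 := by
    have hz' : z ∈ Gᗮ := by
      rw [Submodule.orthogonal_closure, Submodule.mem_orthogonal]
      rintro _ ⟨c, rfl⟩
      simp [lu, Finsupp.linearCombination_apply, Finsupp.sum, sum_inner, inner_smul_left, hz]
    have : G.orthogonalProjectionOnto z = 0 :=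
      G.orthogonalProjectionOnto_eq_zero_iff.mpr hz'
    simp [V, this]
  refine ⟨V, ?_, hVu, ?_⟩
  · calc ‖V‖ ≤ ‖V₀‖ * ‖G.orthogonalProjectionOnto‖ := opNorm_comp_le _ _
      _ ≤ 1 * 1 := mul_le_mul (LinearMap.opNorm_extendOfNorm_le hdense zero_le_one hbd)
          G.orthogonalProjectionOnto_norm_le (opNorm_nonneg _) zero_le_one
      _ = 1 := one_mul 1
  · intro X₁ X f g hX₁ hX hX₁'
    ext z
    have hz : z = (G.orthogonalProjectionOnto z : K₁) + (z - G.orthogonalProjectionOnto z) := by abel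
    have hperp : z - G.orthogonalProjectionOnto z ∈ Gᗮ := G.sub_starProjection_mem_orthogonal z
    generalize z - (G.orthogonalProjectionOnto z : K₁) = y at hz hperp
    have hy (a : ι) : inner ℂ (u a) y = 0 := by
      have : u a ∈ G := by simpa [lu] using hmemG (Finsupp.single a 1)
      exact hperp _ this
    -- The adjoint of `X₁` permutes indices of `u`, hence `X₁` preserves `Gᗮ`, where `V` vanishes.
    have hXy : V (X₁ y) = 0 := hVperp fun a => by
      rw [← adjoint_inner_left, hX₁', hy]
    have hG : ∀ x : G, V (X₁ x) = X (V x) := fun x => by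
      refine hdense.induction_on (p := fun x : G => V (X₁ x) = X (V x)) x
        (isClosed_eq (by fun_prop) (by fun_prop)) fun c => ?_
      change V (X₁ (lu c)) = X (V (lu c))
      simp only [lu, Finsupp.linearCombination_apply, Finsupp.sum, map_sum, map_smul, hX₁, hVu, hX]
    have h := hG (G.orthogonalProjectionOnto z)
    rw [hz]
    simp only [comp_apply, map_add, hXy, hVperp hy, h, map_zero]

end HilbertSpace

/-! ### Operators on the interior tensor product -/

section InteriorTensorOperators

open ContinuousLinearMap TensorProduct

lemma norm_pow_apply_le {G : Type*} [SeminormedAddCommGroup G] [NormedSpace ℂ G] (S : G →L[ℂ] G)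
    (n : ℕ) (g : G) : ‖(S ^ n) g‖ ≤ ‖S‖ ^ n * ‖g‖ := by
  induction n with
  | zero => simp
  | succ n ih =>
    rw [pow_succ', mul_apply_eq_comp, pow_succ', mul_assoc]
    exact (S.le_opNorm _).trans (mul_le_mul_of_nonneg_left ih (opNorm_nonneg _))

variable {H : Type*} [NormedAddCommGroup H] [InnerProductSpace ℂ H] [CompleteSpace H]
variable (C : VonNeumannAlgebra H)
variable {E : Type*} [NormedAddCommGroup E] [NormedSpace ℂ E] [Module Cᵐᵒᵖ E] [CStarModule Cᵐᵒᵖ E]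

lemma interiorL_apply (x : E) (h : H) : interiorL C x h = interiorTmul C x h := rfl

lemma interiorTensor_induction {p : InteriorTensor C E → Prop} (t : InteriorTensor C E)
    (hcl : IsClosed {t | p t}) (hz : p 0) (hadd : ∀ t u, p t → p u → p (t + u))
    (htmul : ∀ x h, p (interiorTmul C x h)) : p t := by
  refine UniformSpace.Completion.induction_on t hcl fun s => ?_
  obtain ⟨s, rfl⟩ := (toPreInteriorTensor C E).surjective s
  induction s with
  | zero => rwa [map_zero, UniformSpace.Completion.coe_zero]
  | add a b ha hb => simpa [UniformSpace.Completion.coe_add] using hadd _ _ ha hb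
  | tmul x h => exact htmul x h

lemma interiorTensor_clm_ext {G : Type*} [NormedAddCommGroup G] [NormedSpace ℂ G]
    {S T : InteriorTensor C E →L[ℂ] G}
    (hST : ∀ x h, S (interiorTmul C x h) = T (interiorTmul C x h)) : S = T := by
  ext t
  refine interiorTensor_induction C t (isClosed_eq S.continuous T.continuous) (by simp) ?_ hST
  intro t u ht hu
  rw [map_add, map_add, ht, hu]

lemma interiorTensor_ext_inner {t u : InteriorTensor C E}
    (htu : ∀ x h, inner ℂ (interiorTmul C x h) t = inner ℂ (interiorTmul C x h) u) : t = u := by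
  have : innerSL ℂ t = innerSL ℂ u := interiorTensor_clm_ext C fun x h => by
    simp only [innerSL_apply_apply]
    rw [← inner_conj_symm, htu, inner_conj_symm]
  exact (innerSL_inj (𝕜 := ℂ)).mp this

/-- The identity `L_x* L_y = ⟨x, y⟩` translates the module structure into operator language; in
particular `x ↦ L_x` is isometric, so identities in `E` can be checked in `E ⊗ H`. -/
lemma adjoint_interiorL_comp (x y : E) :
    adjoint (interiorL C x) ∘L interiorL C y = (cInner C x y : H →L[ℂ] H) := by
  ext k
  refine ext_inner_left ℂ fun h => ?_
  rw [comp_apply, adjoint_inner_right]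
  exact inner_interiorTmul C x y h k

lemma norm_interiorL (x : E) : ‖interiorL C x‖ = ‖x‖ := by
  have h1 : ‖x‖ ^ 2 = ‖(cInner C x x : H →L[ℂ] H)‖ := norm_sq_eq_cInner (C := C) x
  rw [← adjoint_interiorL_comp, norm_adjoint_comp_self, ← sq] at h1
  exact ((sq_eq_sq₀ (norm_nonneg _) (norm_nonneg _)).mp h1).symm

lemma interiorL_add (x y : E) : interiorL C (x + y) = interiorL C x + interiorL C y := by
  ext h
  simp only [interiorL_apply, add_apply, interiorTmul, TensorProduct.add_tmul, map_add,
    UniformSpace.Completion.coe_add]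

lemma interiorL_smul (a : ℂ) (x : E) : interiorL C (a • x) = a • interiorL C x := by
  ext h
  simp only [interiorL_apply, smul_apply, interiorTmul, ← TensorProduct.smul_tmul', map_smul,
    UniformSpace.Completion.coe_smul]

/-- The isometry `x ↦ L_x`. -/
noncomputable def interiorLₗᵢ : E →ₗᵢ[ℂ] (H →L[ℂ] InteriorTensor C E) where
  toFun := interiorL C
  map_add' := interiorL_add C
  map_smul' := interiorL_smul C
  norm_map' := norm_interiorL C

lemma interiorL_injective : Function.Injective (interiorL C : E → _) :=
  (interiorLₗᵢ C (E := E)).injective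

lemma interiorTmul_op_smul (c : C) (x : E) (h : H) :
    interiorTmul C (MulOpposite.op c • x) h = interiorTmul C x ((c : H →L[ℂ] H) h) := by
  refine interiorTensor_ext_inner C fun y k => ?_
  rw [inner_interiorTmul, inner_interiorTmul, cInner_op_smul_right]
  rfl

lemma interiorL_op_smul (c : C) (x : E) :
    interiorL C (MulOpposite.op c • x) = interiorL C x ∘L (c : H →L[ℂ] H) := by
  ext h
  exact interiorTmul_op_smul C c x h

/-- An adjointable operator on a Hilbert module over a von Neumann algebra is bounded. -/
lemma continuous_of_adjointable [CompleteSpace E] (a : E →ₗ[ℂ] E) (a' : E → E)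
    (ha : ∀ x y, cInner C (a x) y = cInner C x (a' y)) : Continuous a := by
  -- Closed graph theorem: moving `a` across the inner product turns it into `a'` on the fixed
  -- vector, so the limit `y` of `a (u n)` has the same inner products as `a x`.
  refine a.continuous_of_seq_closed_graph fun u x y hu hau => ?_
  have hL : Continuous (interiorL C : E → _) := (interiorLₗᵢ C (E := E)).continuous
  have key (z : E) (h k : H) :
      inner ℂ (interiorTmul C y h) (interiorTmul C z k)
        = inner ℂ (interiorTmul C (a x) h) (interiorTmul C z k) := by
    have hT (w : E) (k : H) : Continuous fun x : E =>
        (inner ℂ (interiorTmul C x h) (interiorTmul C w k) : ℂ) :=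
      Continuous.inner (hL.clm_apply continuous_const) continuous_const
    have h1 := ((hT z k).tendsto y).comp hau
    have h2 := ((hT (a' z) k).tendsto x).comp hu
    have h3 (x : E) : inner ℂ (interiorTmul C (a x) h) (interiorTmul C z k)
        = inner ℂ (interiorTmul C x h) (interiorTmul C (a' z) k) := by
      rw [inner_interiorTmul, inner_interiorTmul, ha]
    rw [h3]
    refine tendsto_nhds_unique h1 (h2.congr fun n => ?_)
    exact (h3 (u n)).symm
  refine interiorL_injective C ?_
  ext h
  refine interiorTensor_ext_inner C fun z k => ?_
  rw [← inner_conj_symm]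
  change starRingEnd ℂ (inner ℂ (interiorTmul C y h) _) = _
  rw [key, inner_conj_symm]
  rfl

/-- An adjointable operator `a` on `E` and an operator `s` in the commutant of `C` define an
operator `a ⊗ s` on `E ⊗ H`, with adjoint `a* ⊗ s*`. -/
lemma exists_interiorMap [CompleteSpace E] (a a' : E →ₗ[ℂ] E)
    (ha : ∀ x y, cInner C (a x) y = cInner C x (a' y)) (s : H →L[ℂ] H) (hs : s ∈ C.commutant) :
    ∃ A : InteriorTensor C E →L[ℂ] InteriorTensor C E,
      (∀ x h, A (interiorTmul C x h) = interiorTmul C (a x) (s h)) ∧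
      ∀ x h, (adjoint A) (interiorTmul C x h) = interiorTmul C (a' x) (adjoint s h) := by
  have ha' (x y : E) : cInner C (a' x) y = cInner C x (a y) := by
    rw [← star_cInner, ← ha, star_cInner]
  have hsc (c : C) (h : H) : (c : H →L[ℂ] H) (s h) = s ((c : H →L[ℂ] H) h) :=
    DFunLike.congr_fun (VonNeumannAlgebra.mem_commutant_iff.mp hs c c.2) h
  let e := toPreInteriorTensor C E
  let A₀ : PreInteriorTensor C E →ₗ[ℂ] PreInteriorTensor C E :=
    e.toLinearMap ∘ₗ TensorProduct.map a (s : H →ₗ[ℂ] H) ∘ₗ e.symm.toLinearMap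
  let A₁ : PreInteriorTensor C E →ₗ[ℂ] PreInteriorTensor C E :=
    e.toLinearMap ∘ₗ TensorProduct.map a' (adjoint s : H →ₗ[ℂ] H) ∘ₗ e.symm.toLinearMap
  have hA₀ (x : E) (h : H) : A₀ (e (x ⊗ₜ h)) = e (a x ⊗ₜ s h) := by simp [A₀]
  have hA₁ (x : E) (h : H) : A₁ (e (x ⊗ₜ h)) = e (a' x ⊗ₜ adjoint s h) := by simp [A₁]
  have hinner (x y : E) (h k : H) : inner ℂ (e (x ⊗ₜ h)) (e (y ⊗ₜ k))
      = inner ℂ h ((cInner C x y : H →L[ℂ] H) k) := interiorForm_tmul C E x y h k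
  have hadj (t u : PreInteriorTensor C E) : inner ℂ (A₀ t) u = inner ℂ t (A₁ u) := by
    obtain ⟨t, rfl⟩ := e.surjective t
    obtain ⟨u, rfl⟩ := e.surjective u
    induction t with
    | zero => simp
    | add t t' ht ht' => simp only [map_add, inner_add_left, ht, ht']
    | tmul x h =>
      induction u with
      | zero => simp
      | add u u' hu hu' => simp only [map_add, inner_add_right, hu, hu']
      | tmul y k =>
        rw [hA₀, hA₁, hinner, hinner, ha, ← adjoint_inner_right]
        congr 1
        have h1 := VonNeumannAlgebra.mem_commutant_iff.mp (star_mem hs) _ (cInner C x (a' y)).2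
        exact (DFunLike.congr_fun h1 k).symm
  let a₁ : E →L[ℂ] E := ⟨a, continuous_of_adjointable C a a' ha⟩
  let a₂ : E →L[ℂ] E := ⟨a', continuous_of_adjointable C a' a ha'⟩
  set M : ℝ := ‖a₂ ∘L a₁‖ * ‖adjoint s ∘L s‖ with hM
  have hM0 : 0 ≤ M := by positivity
  -- On an elementary tensor the powers of `A₁ A₀` factor as `(a* a)ⁿ x ⊗ (s* s)ⁿ h`, which grow at
  -- most like `Mⁿ`. On sums only the constant `c` changes, and the growth bound then yields the
  -- norm bound `√M` independently of the representation as a sum.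
  have hgrowth (t : PreInteriorTensor C E) :
      ∃ c : ℝ, ∀ n : ℕ, ‖((A₁ ∘ₗ A₀) ^ n) t‖ ≤ c * M ^ n := by
    obtain ⟨t, rfl⟩ := e.surjective t
    induction t with
    | zero => exact ⟨0, by simp⟩
    | add t u ht hu =>
      obtain ⟨c, hc⟩ := ht
      obtain ⟨d, hd⟩ := hu
      refine ⟨c + d, fun n => ?_⟩
      rw [map_add, map_add, add_mul]
      exact (norm_add_le _ _).trans (add_le_add (hc n) (hd n))
    | tmul x h =>
      refine ⟨‖x‖ * ‖h‖, fun n => ?_⟩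
      have hpow : ((A₁ ∘ₗ A₀) ^ n) (e (x ⊗ₜ h))
          = e (((a₂ ∘L a₁) ^ n) x ⊗ₜ ((adjoint s ∘L s) ^ n) h) := by
        induction n with
        | zero => simp
        | succ n ih =>
          rw [pow_succ', Module.End.mul_apply, ih, LinearMap.comp_apply, hA₀, hA₁, pow_succ',
            pow_succ']
          rfl
      rw [hpow]
      have hle (x : E) (h : H) : ‖e (x ⊗ₜ h)‖ ≤ ‖x‖ * ‖h‖ := by
        have := norm_interiorTmul_le C x h
        rwa [interiorTmul, UniformSpace.Completion.norm_coe] at this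
      calc _ ≤ _ := hle _ _
        _ ≤ (‖a₂ ∘L a₁‖ ^ n * ‖x‖) * (‖adjoint s ∘L s‖ ^ n * ‖h‖) :=
          mul_le_mul (norm_pow_apply_le _ _ _) (norm_pow_apply_le _ _ _) (norm_nonneg _) (by positivity)
        _ = ‖x‖ * ‖h‖ * M ^ n := by rw [hM, mul_pow]; ring
  have hnorm (t : PreInteriorTensor C E) : ‖A₀ t‖ ≤ √M * ‖t‖ := by
    obtain ⟨c, hc⟩ := hgrowth t
    have h1 := norm_sq_le_of_pow_adjoint_mul_self_le A₀ A₁ hadj hM0 t hc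
    rw [← sq_le_sq₀ (norm_nonneg _) (by positivity), mul_pow, Real.sq_sqrt hM0]
    exact h1
  let A₂ : PreInteriorTensor C E →L[ℂ] PreInteriorTensor C E := A₀.mkContinuous (√M) hnorm
  let A : InteriorTensor C E →L[ℂ] InteriorTensor C E := A₂.completion
  have hA (x : E) (h : H) : A (interiorTmul C x h) = interiorTmul C (a x) (s h) := by
    rw [interiorTmul, ContinuousLinearMap.completion_apply_coe]
    exact congrArg _ (hA₀ x h)
  refine ⟨A, hA, fun x h => ?_⟩
  refine interiorTensor_ext_inner C fun y k => ?_
  rw [adjoint_inner_right, hA, inner_interiorTmul, inner_interiorTmul, ha,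
    ← adjoint_inner_right]
  congr 1
  have h1 := VonNeumannAlgebra.mem_commutant_iff.mp (star_mem hs) _ (cInner C y (a' x)).2
  exact (DFunLike.congr_fun h1 h).symm

end InteriorTensorOperators

/-! ### Finite amplifications -/

section Amplification

open ContinuousLinearMap

variable {H G : Type*} [NormedAddCommGroup H] [InnerProductSpace ℂ H]
  [NormedAddCommGroup G] [InnerProductSpace ℂ G]

variable (ι : Type*)

/-- The diagonal operator `A ⊕ ⋯ ⊕ A`. -/
noncomputable def amplification (A : H →L[ℂ] G) :
    PiLp 2 (fun _ : ι => H) →L[ℂ] PiLp 2 (fun _ : ι => G) :=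
  ((PiLp.continuousLinearEquiv 2 ℂ fun _ : ι => G).symm :
      (ι → G) →L[ℂ] PiLp 2 (fun _ : ι => G)) ∘L
    ContinuousLinearMap.piMap (fun _ : ι => A) ∘L
      ((PiLp.continuousLinearEquiv 2 ℂ fun _ : ι => H) :
        PiLp 2 (fun _ : ι => H) →L[ℂ] (ι → H))

variable {ι}

lemma amplification_apply (A : H →L[ℂ] G) (z : PiLp 2 (fun _ : ι => H)) (i : ι) :
    amplification ι A z i = A (z i) := rfl

variable (H) in
/-- The `i`-th coordinate as an operator. -/
noncomputable abbrev coordProj (i : ι) : PiLp 2 (fun _ : ι => H) →L[ℂ] H :=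
  PiLp.proj (𝕜 := ℂ) 2 (fun _ : ι => H) i

lemma coordProj_comp_amplification (A : H →L[ℂ] G) (i : ι) :
    coordProj G i ∘L amplification ι A = A ∘L coordProj H i := rfl

variable [CompleteSpace H] [CompleteSpace G]

/-- `A` maps `M` into `N`, and the condition on the adjoint says that `A` maps `Mᗮ` into `Nᗮ`. -/
lemma comp_starProjection_of_mapsTo {M : Submodule ℂ H} {N : Submodule ℂ G}
    [M.HasOrthogonalProjection] [N.HasOrthogonalProjection] (A : H →L[ℂ] G)
    (hA : ∀ x ∈ M, A x ∈ N) (hA' : ∀ y ∈ N, adjoint A y ∈ M) :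
    A ∘L M.starProjection = N.starProjection ∘L A := by
  ext z
  refine (Submodule.eq_starProjection_of_mem_orthogonal
    (hA _ (M.starProjection_apply_mem z)) ?_).symm
  rw [Submodule.mem_orthogonal]
  intro y hy
  change inner ℂ y (A z - A (M.starProjection z)) = 0
  rw [← map_sub, ← adjoint_inner_left]
  exact M.sub_starProjection_mem_orthogonal z _ (hA' y hy)

variable [Fintype ι]

lemma adjoint_amplification (A : H →L[ℂ] G) :
    adjoint (amplification ι A) = amplification ι (adjoint A) := by
  refine ((eq_adjoint_iff _ _).mpr fun x y => ?_).symm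
  simp only [PiLp.inner_apply, amplification_apply, adjoint_inner_left]

lemma amplification_comp_adjoint_coordProj (A : H →L[ℂ] G) (i : ι) :
    amplification ι A ∘L adjoint (coordProj H i) = adjoint (coordProj G i) ∘L A := by
  have h := congrArg adjoint (coordProj_comp_amplification (adjoint A) i)
  rwa [adjoint_comp, adjoint_comp, adjoint_amplification, adjoint_adjoint] at h

lemma sum_adjoint_coordProj (z : PiLp 2 (fun _ : ι => H)) :
    ∑ i, adjoint (coordProj H i) (z i) = z := by
  refine ext_inner_left ℂ fun w => ?_
  simp only [inner_sum, adjoint_inner_right, PiLp.inner_apply]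
  rfl

end Amplification

/-! ### Von Neumann modules and the double commutant argument -/

section VonNeumannModule

open ContinuousLinearMap

variable {H : Type*} [NormedAddCommGroup H] [InnerProductSpace ℂ H] [CompleteSpace H]
variable (C : VonNeumannAlgebra H)
variable {E : Type*} [NormedAddCommGroup E] [NormedSpace ℂ E] [Module Cᵐᵒᵖ E] [CStarModule Cᵐᵒᵖ E]

/-- An operator `y : H → E ⊗ H` which intertwines `s` and `1 ⊗ s` for all `s` in the commutant of
`C` is, on finitely many vectors, a limit of the operators `L_x`. -/
lemma mem_closure_range_interiorTmul (y : H →L[ℂ] InteriorTensor C E)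
    (hy : ∀ s ∈ C.commutant, ∀ R : InteriorTensor C E →L[ℂ] InteriorTensor C E,
      (∀ x h, R (interiorTmul C x h) = interiorTmul C x (s h)) → y ∘L s = R ∘L y)
    {ι : Type*} [Fintype ι] (ξ : ι → H) :
    (fun i => y (ξ i)) ∈ closure (Set.range fun (x : E) (i : ι) => interiorTmul C x (ξ i)) := by
  let ξ' : PiLp 2 (fun _ : ι => H) := WithLp.toLp 2 ξ
  let evC : C →ₗ[ℂ] PiLp 2 (fun _ : ι => H) :=
    { toFun := fun c => amplification ι (c : H →L[ℂ] H) ξ'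
      map_add' := fun _ _ => rfl
      map_smul' := fun _ _ => rfl }
  let evE : E →ₗ[ℂ] PiLp 2 (fun _ : ι => InteriorTensor C E) :=
    { toFun := fun x => amplification ι (interiorL C x) ξ'
      map_add' := fun a b => by rw [interiorL_add]; rfl
      map_smul' := fun a b => by rw [interiorL_smul]; rfl }
  -- As in the double commutant theorem: `M` is the closure of `C ξ` in `Hⁿ` and `N` that of the
  -- vectors `(x ⊗ ξᵢ)ᵢ`. Amplified `L_x` maps `M` to `N` and its adjoint maps `N` to `M`, so it
  -- intertwines the two projections.
  let M := (LinearMap.range evC).topologicalClosure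
  let N := (LinearMap.range evE).topologicalClosure
  have : CompleteSpace M := (Submodule.isClosed_topologicalClosure _).completeSpace_coe
  have : CompleteSpace N := (Submodule.isClosed_topologicalClosure _).completeSpace_coe
  have hmapsC (c : C) : ∀ z ∈ M, amplification ι (c : H →L[ℂ] H) z ∈ M := by
    refine fun z hz => map_mem_closure (amplification ι (c : H →L[ℂ] H)).continuous hz ?_
    rintro _ ⟨d, rfl⟩
    exact ⟨c * d, rfl⟩
  have hmapsL (x : E) : ∀ z ∈ M, amplification ι (interiorL C x) z ∈ N := by
    refine fun z hz => map_mem_closure (amplification ι (interiorL C x)).continuous hz ?_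
    rintro _ ⟨d, rfl⟩
    refine ⟨MulOpposite.op d • x, ?_⟩
    change amplification ι (interiorL C (MulOpposite.op d • x)) ξ' = _
    rw [interiorL_op_smul]
    rfl
  have hmapsL' (x : E) : ∀ z ∈ N, adjoint (amplification ι (interiorL C x)) z ∈ M := by
    refine fun z hz =>
      map_mem_closure (adjoint (amplification ι (interiorL C x))).continuous hz ?_
    rintro _ ⟨w, rfl⟩
    refine ⟨cInner C x w, ?_⟩
    change amplification ι (cInner C x w : H →L[ℂ] H) ξ' = _
    rw [← adjoint_interiorL_comp, adjoint_amplification]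
    rfl
  have hcomC (c : C) := comp_starProjection_of_mapsTo (amplification ι (c : H →L[ℂ] H)) (hmapsC c)
    (fun z hz => by
      rw [adjoint_amplification]
      exact hmapsC (star c) z hz)
  have hcomL (x : E) :=
    comp_starProjection_of_mapsTo (amplification ι (interiorL C x)) (hmapsL x) (hmapsL' x)
  -- Matrix entries of the two projections: `p i j` lies in the commutant of `C`, and `q i j` acts
  -- as `1 ⊗ p i j`, so the hypothesis on `y` applies to this pair.
  let p (i j : ι) : H →L[ℂ] H := coordProj H i ∘L M.starProjection ∘L adjoint (coordProj H j)
  let q (i j : ι) : InteriorTensor C E →L[ℂ] InteriorTensor C E :=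
    coordProj _ i ∘L N.starProjection ∘L adjoint (coordProj _ j)
  have hp (i j : ι) : p i j ∈ C.commutant := by
    refine VonNeumannAlgebra.mem_commutant_iff.mpr fun c hc => ?_
    change (c ∘L coordProj H i) ∘L M.starProjection ∘L adjoint (coordProj H j)
      = coordProj H i ∘L M.starProjection ∘L adjoint (coordProj H j) ∘L c
    rw [← coordProj_comp_amplification, ← amplification_comp_adjoint_coordProj]
    have := hcomC ⟨c, hc⟩
    ext z
    exact congrArg (fun w => w i) (DFunLike.congr_fun this (adjoint (coordProj H j) z))
  have hq (i j : ι) (x : E) (h : H) :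
      q i j (interiorTmul C x h) = interiorTmul C x (p i j h) := by
    have h1 := DFunLike.congr_fun (amplification_comp_adjoint_coordProj (interiorL C x) j) h
    have h2 := DFunLike.congr_fun (hcomL x) (adjoint (coordProj H j) h)
    simp only [comp_apply] at h1 h2
    rw [h1] at h2
    exact congrArg (fun w => w i) h2.symm
  have hξ : M.starProjection ξ' = ξ' := by
    refine Submodule.starProjection_eq_self_iff.mpr (Submodule.le_topologicalClosure _ ⟨1, ?_⟩)
    rfl
  -- Since `1 ∈ C`, the projection onto `M` fixes `ξ'`; passing it through `y` entry by entry gives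
  -- the projection onto `N`.
  have hyN : amplification ι y ξ' = N.starProjection (amplification ι y ξ') := by
    ext i
    calc amplification ι y ξ' i = y (∑ j, p i j (ξ j)) := by
          rw [amplification_apply]
          congr 1
          conv_lhs => rw [← hξ, ← sum_adjoint_coordProj ξ', map_sum]
          exact map_sum (coordProj H i) _ _
      _ = ∑ j, q i j (y (ξ j)) := by
          rw [map_sum]
          exact Finset.sum_congr rfl fun j _ =>
            DFunLike.congr_fun (hy (p i j) (hp i j) (q i j) (hq i j)) (ξ j)
      _ = N.starProjection (amplification ι y ξ') i := by
          conv_rhs => rw [← sum_adjoint_coordProj (amplification ι y ξ'), map_sum]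
          exact (map_sum (coordProj (InteriorTensor C E) i) _ _).symm
  have hmem : amplification ι y ξ' ∈ N := Submodule.starProjection_eq_self_iff.mp hyN.symm
  refine map_mem_closure
    (PiLp.continuousLinearEquiv 2 ℂ fun _ : ι => InteriorTensor C E).continuous hmem ?_
  rintro _ ⟨x, rfl⟩
  exact ⟨x, rfl⟩

/-- In a von Neumann module, the operators `L_x` are all the operators which intertwine the
commutant of `C`. -/
lemma IsVonNeumannModule.exists_interiorL_eq (hE : IsVonNeumannModule C E)
    (y : H →L[ℂ] InteriorTensor C E)
    (hy : ∀ s ∈ C.commutant, ∀ R : InteriorTensor C E →L[ℂ] InteriorTensor C E,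
      (∀ x h, R (interiorTmul C x h) = interiorTmul C x (s h)) → y ∘L s = R ∘L y) :
    ∃ x, interiorL C x = y := by
  suffices h : ContinuousLinearMap.toPointwiseConvergenceCLM ℂ (RingHom.id ℂ) H
      (InteriorTensor C E) y ∈ closure (Set.range fun x : E =>
        ContinuousLinearMap.toPointwiseConvergenceCLM ℂ (RingHom.id ℂ) H (InteriorTensor C E)
          (interiorL C x)) by
    obtain ⟨x, hx⟩ := hE.closure_eq ▸ h
    exact ⟨x, hx⟩
  -- A basic neighbourhood in the topology of pointwise convergence tests only finitely many
  -- vectors, so the finite approximation suffices.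
  rw [(PointwiseConvergenceCLM.isEmbedding_coeFn _ _ _).isInducing.closure_eq_preimage_closure_image,
    Set.mem_preimage, mem_closure_iff]
  intro O hO hyO
  obtain ⟨I, W, hW, hWO⟩ := isOpen_pi_iff.mp hO _ hyO
  obtain ⟨_, hx, x, rfl⟩ := mem_closure_iff.mp
    (mem_closure_range_interiorTmul C y hy (fun i : I => (i : H)))
    (Set.univ.pi fun i : I => W i) (isOpen_set_pi Set.finite_univ fun i _ => (hW i i.2).1)
    (fun i _ => (hW i i.2).2)
  exact ⟨_, hWO fun i hi => hx ⟨i, hi⟩ trivial, _, ⟨x, rfl⟩, rfl⟩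

end VonNeumannModule

/-! ### The contraction `T` and its defect operator -/

section Dilation

open ContinuousLinearMap

variable {K₁ K₂ K : Type*} [NormedAddCommGroup K₁] [InnerProductSpace ℂ K₁] [CompleteSpace K₁]
  [NormedAddCommGroup K₂] [InnerProductSpace ℂ K₂] [CompleteSpace K₂]
  [NormedAddCommGroup K] [InnerProductSpace ℂ K] [CompleteSpace K]

/-- `D` is the square root of `1 - T* T` given by the continuous functional calculus, which is why
it commutes with all that commutes with `T* T`. -/
lemma exists_sq_eq_one_sub (T : K₂ →L[ℂ] K₁) (hT : ‖T‖ ≤ 1) :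
    ∃ D : K₂ →L[ℂ] K₂, adjoint D = D ∧ adjoint T ∘L T + D ∘L D = 1 ∧
      ∀ X : K₂ →L[ℂ] K₂, Commute (adjoint T ∘L T) X → Commute D X := by
  have hpos : 0 ≤ adjoint T ∘L T := by
    rw [nonneg_iff_isPositive]
    exact isPositive_adjoint_comp_self T
  have hle : adjoint T ∘L T ≤ 1 := by
    refine (CStarAlgebra.norm_le_one_iff_of_nonneg _ hpos).mp ?_
    rw [norm_adjoint_comp_self]
    exact mul_le_one₀ hT (norm_nonneg _) hT
  have h1 : 0 ≤ 1 - adjoint T ∘L T := sub_nonneg.mpr hle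
  refine ⟨CFC.sqrt (1 - adjoint T ∘L T), (CFC.sqrt_nonneg _).isSelfAdjoint, ?_, fun X hX => ?_⟩
  · have := CFC.sqrt_mul_sqrt_self _ h1
    rw [mul_def] at this
    rw [this, add_sub_cancel]
  · exact Commute.cfcₙ_nnreal ((Commute.one_left X).sub_left hX) NNReal.sqrt

lemma adjoint_comp_add_adjoint_comp {G : Type*} [NormedAddCommGroup G] [InnerProductSpace ℂ G]
    [CompleteSpace G] {T : K₂ →L[ℂ] K₁} {D : K₂ →L[ℂ] K₂} (hD : adjoint D = D)
    (hTD : adjoint T ∘L T + D ∘L D = 1) (L M : G →L[ℂ] K₂) :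
    adjoint (T ∘L L) ∘L (T ∘L M) + adjoint (D ∘L L) ∘L (D ∘L M) = adjoint L ∘L M := by
  have h : (adjoint T ∘L T + D ∘L D) ∘L M = M := by rw [hTD]; rfl
  rw [← congrArg (fun S => adjoint L ∘L S) h, adjoint_comp, adjoint_comp, hD, add_comp, comp_add]
  rfl

/-- Two pairs of families `u₁, v₁` and `u₂, v₂` with the same Gram matrices give a contraction `T`
with `⟨u₁, T u₂⟩ = ⟨v₁, v₂⟩`. This contraction and the square root `D` of `1 - T* T` intertwine all
operators that act on the four families by the same map of indices. -/
lemma exists_contraction_of_inner_eq {ι : Type*} (u₁ : ι → K₁) (u₂ : ι → K₂) (v₁ v₂ : ι → K)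
    (h₁ : ∀ a b, inner ℂ (u₁ a) (u₁ b) = inner ℂ (v₁ a) (v₁ b))
    (h₂ : ∀ a b, inner ℂ (u₂ a) (u₂ b) = inner ℂ (v₂ a) (v₂ b)) :
    ∃ (T : K₂ →L[ℂ] K₁) (D : K₂ →L[ℂ] K₂), adjoint D = D ∧ adjoint T ∘L T + D ∘L D = 1 ∧
      (∀ a b, inner ℂ (u₁ a) (T (u₂ b)) = inner ℂ (v₁ a) (v₂ b)) ∧
      ∀ (X₁ : K₁ →L[ℂ] K₁) (X₂ : K₂ →L[ℂ] K₂) (X : K →L[ℂ] K) (f g : ι → ι),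
        (∀ a, X₁ (u₁ a) = u₁ (f a)) → (∀ a, adjoint X₁ (u₁ a) = u₁ (g a)) →
        (∀ a, X₂ (u₂ a) = u₂ (f a)) → (∀ a, adjoint X₂ (u₂ a) = u₂ (g a)) →
        (∀ a, X (v₁ a) = v₁ (f a)) → (∀ a, adjoint X (v₁ a) = v₁ (g a)) →
        (∀ a, X (v₂ a) = v₂ (f a)) → (∀ a, adjoint X (v₂ a) = v₂ (g a)) →
        T ∘L X₂ = X₁ ∘L T ∧ D ∘L X₂ = X₂ ∘L D := by
  obtain ⟨V₁, hV₁, hVu₁, hX₁⟩ := exists_partialIsometry_of_inner_eq u₁ v₁ h₁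
  obtain ⟨V₂, hV₂, hVu₂, hX₂⟩ := exists_partialIsometry_of_inner_eq u₂ v₂ h₂
  have hT : ‖adjoint V₁ ∘L V₂‖ ≤ 1 := by
    refine (opNorm_comp_le _ _).trans ?_
    rw [LinearIsometryEquiv.norm_map]
    exact mul_le_one₀ hV₁ (norm_nonneg _) hV₂
  obtain ⟨D, hD, hTD, hcomm⟩ := exists_sq_eq_one_sub (adjoint V₁ ∘L V₂) hT
  refine ⟨adjoint V₁ ∘L V₂, D, hD, hTD, fun a b => ?_, ?_⟩
  · rw [comp_apply, adjoint_inner_right, hVu₁, hVu₂]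
  intro X₁ X₂ X f g a₁ a₁' a₂ a₂' a a' b b'
  -- The hypotheses are symmetric in operators and adjoints, so `V₁` and `V₂` also intertwine the
  -- adjoints. Taking adjoints makes `V₁*` and `V₂*` intertwiners, hence `T` and `T*`, hence `X₂`
  -- commutes with `T* T` and with `D`.
  have e₁ := hX₁ X₁ X f g a₁ a a₁'
  have e₂ := hX₂ X₂ X f g a₂ b a₂'
  have e₁' := hX₁ (adjoint X₁) (adjoint X) g f a₁' a' (by simpa using a₁)
  have e₂' := hX₂ (adjoint X₂) (adjoint X) g f a₂' b' (by simpa using a₂)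
  have s₁ := congrArg adjoint e₁
  have s₂ := congrArg adjoint e₂
  have s₁' := congrArg adjoint e₁'
  have s₂' := congrArg adjoint e₂'
  simp only [adjoint_comp, adjoint_adjoint] at s₁ s₂ s₁' s₂'
  have hTX : (adjoint V₁ ∘L V₂) ∘L X₂ = X₁ ∘L adjoint V₁ ∘L V₂ := by
    rw [comp_assoc, e₂, ← comp_assoc, ← s₁', comp_assoc]
  have hTX' : adjoint (adjoint V₁ ∘L V₂) ∘L X₁ = X₂ ∘L adjoint (adjoint V₁ ∘L V₂) := by
    rw [adjoint_comp, adjoint_adjoint, comp_assoc, e₁, ← comp_assoc, ← s₂', comp_assoc]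
  refine ⟨hTX, hcomm X₂ ?_⟩
  change (adjoint (adjoint V₁ ∘L V₂) ∘L adjoint V₁ ∘L V₂) ∘L X₂
    = X₂ ∘L adjoint (adjoint V₁ ∘L V₂) ∘L adjoint V₁ ∘L V₂
  rw [comp_assoc, hTX, ← comp_assoc, hTX', comp_assoc]

end Dilation

/-! ### Inner products in a decomposition -/

namespace SCorrespondence

open ContinuousLinearMap

section Gram

variable {B : Type u} {C : Type v} [CStarAlgebra B] [CStarAlgebra C] [PartialOrder C]
  {F : SCorrespondence.{u, v, w} B C} {α : B ≃⋆ₐ[ℂ] B} {Ω : Type*} {K : Ω → Ω → B →L[ℂ] C}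
  {i : Ω → F.carrier}

lemma Decomposes.U_π (h : F.Decomposes α K i) (b : B) (σ : Ω) :
    F.U (F.π b (i σ)) = F.π (α b) (i σ) := by
  simpa using h.U_apply b σ 1

lemma Decomposes.U_symm_π (h : F.Decomposes α K i) (b : B) (σ : Ω) :
    F.U.symm (F.π b (i σ)) = F.π (α.symm b) (i σ) := by
  rw [LinearEquiv.symm_apply_eq, h.U_π, StarAlgEquiv.apply_symm_apply]

/-- Writing `d i(τ) = U (α⁻¹(d) i(τ))` brings the inner product into the form `[·, ·]`, across which
`b` moves as `b*`. The outcome no longer refers to `F`. -/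
lemma Decomposes.cInner_π_π (h : F.Decomposes α K i) (b d : B) (σ τ : Ω) :
    cInner C (F.π b (i σ)) (F.π d (i τ)) = K σ τ (α (star b) * d) := by
  have h1 : F.π d (i τ) = F.U (F.π (α.symm d) (i τ)) := by
    rw [h.U_π, StarAlgEquiv.apply_symm_apply]
  rw [h1, F.π_natural, ← Module.End.mul_apply, ← map_mul, h.U_π, map_mul,
    StarAlgEquiv.apply_symm_apply, h.kernel_eq]

lemma Decomposes.cInner_self (h : F.Decomposes α K i) (σ τ : Ω) :
    cInner C (i σ) (i τ) = K σ τ 1 := by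
  rw [h.kernel_eq, map_one, Module.End.one_apply]

end Gram

/-! ### Left action, unitary and commutant on `F ⊗ H` -/

section Interior

variable {B : Type u} [CStarAlgebra B] {H : Type v} [NormedAddCommGroup H] [InnerProductSpace ℂ H]
  [CompleteSpace H] {C : VonNeumannAlgebra H} (F : SCorrespondence.{u, v, w} B C)

/-- Naturality says that the adjoint of `π b` is `U π(b*) U⁻¹`. -/
lemma exists_π_interior (b : B) :
    ∃ A : InteriorTensor C F.carrier →L[ℂ] InteriorTensor C F.carrier,
      (∀ x h, A (interiorTmul C x h) = interiorTmul C (F.π b x) h) ∧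
      ∀ x h, adjoint A (interiorTmul C x h)
        = interiorTmul C (F.U (F.π (star b) (F.U.symm x))) h := by
  have h := exists_interiorMap C (F.π b)
    (F.U.toLinearMap ∘ₗ F.π (star b) ∘ₗ F.U.symm.toLinearMap) (fun x y => by
      have := F.π_natural b x (F.U.symm y)
      rwa [LinearEquiv.apply_symm_apply] at this) 1 (one_mem _)
  obtain ⟨A, hA, hA'⟩ := h
  refine ⟨A, hA, fun x h => ?_⟩
  have h1 : adjoint (1 : H →L[ℂ] H) = 1 := star_one _
  rw [hA', h1]
  rfl

lemma exists_U_interior :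
    ∃ A : InteriorTensor C F.carrier →L[ℂ] InteriorTensor C F.carrier,
      (∀ x h, A (interiorTmul C x h) = interiorTmul C (F.U x) h) ∧
      ∀ x h, adjoint A (interiorTmul C x h) = interiorTmul C (F.U.symm x) h := by
  obtain ⟨A, hA, hA'⟩ := exists_interiorMap C F.U.toLinearMap F.U.symm.toLinearMap
    F.cInner_U_left 1 (one_mem _)
  refine ⟨A, hA, fun x h => ?_⟩
  have h1 : adjoint (1 : H →L[ℂ] H) = 1 := star_one _
  rw [hA', h1]
  rfl

lemma exists_commutant_interior {s : H →L[ℂ] H} (hs : s ∈ C.commutant) :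
    ∃ A : InteriorTensor C F.carrier →L[ℂ] InteriorTensor C F.carrier,
      (∀ x h, A (interiorTmul C x h) = interiorTmul C x (s h)) ∧
      ∀ x h, adjoint A (interiorTmul C x h) = interiorTmul C x (adjoint s h) :=
  exists_interiorMap C LinearMap.id LinearMap.id (fun _ _ => rfl) s hs

lemma π_interior_comp_interiorL {b : B}
    {A : InteriorTensor C F.carrier →L[ℂ] InteriorTensor C F.carrier}
    (hA : ∀ x h, A (interiorTmul C x h) = interiorTmul C (F.π b x) h) (x : F.carrier) :
    A ∘L interiorL C x = interiorL C (F.π b x) :=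
  ContinuousLinearMap.ext fun h => hA x h

end Interior

end SCorrespondence

section CInner

variable {C : Type*} [CStarAlgebra C] [PartialOrder C]
variable {E : Type*} [NormedAddCommGroup E] [NormedSpace ℂ E] [Module Cᵐᵒᵖ E] [CStarModule Cᵐᵒᵖ E]

lemma cInner_zero_right (x : E) : cInner C x 0 = 0 := by
  simp [cInner]

lemma cInner_zero_left (x : E) : cInner C 0 x = 0 := by
  simp [cInner]

lemma cInner_sub_sub (x y : E) : cInner C (x - y) (x - y)
    = cInner C x x - cInner C x y - star (cInner C x y) + cInner C y y := by
  rw [star_cInner]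
  simp only [cInner, CStarModule.inner_sub_left, CStarModule.inner_sub_right, MulOpposite.unop_sub]
  abel

end CInner

/-! ### Direct sums, cyclic vectors and the transport to `F₁ ⊕ F₂` -/

namespace SCorrespondence

open ContinuousLinearMap

section DirectSum

variable {B : Type u} {C : Type v} [CStarAlgebra B] [CStarAlgebra C] [PartialOrder C]
  [StarOrderedRing C] {F₁ F₂ : SCorrespondence.{u, v, w} B C}

lemma cInner_directSumMk (x x' : F₁.carrier) (y y' : F₂.carrier) :
    cInner C (directSumMk F₁ F₂ x y) (directSumMk F₁ F₂ x' y')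
      = cInner C x x' + cInner C y y' := rfl

lemma op_smul_directSumMk (c : C) (x : F₁.carrier) (y : F₂.carrier) :
    MulOpposite.op c • directSumMk F₁ F₂ x y
      = directSumMk F₁ F₂ (MulOpposite.op c • x) (MulOpposite.op c • y) := rfl

lemma decomposes_directSum {α : B ≃⋆ₐ[ℂ] B} {Ω : Type*} {K : Ω → Ω → B →L[ℂ] C}
    {t : Ω → F₁.carrier} {d : Ω → F₂.carrier}
    (hK : ∀ σ τ b, K σ τ b = cInner C (t σ) (F₁.π b (t τ)) + cInner C (d σ) (F₂.π b (d τ)))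
    (hK' : ∀ σ τ b, K σ τ b = cInner C (F₁.π (α (star b)) (t σ)) (t τ)
      + cInner C (F₂.π (α (star b)) (d σ)) (d τ))
    (ht : ∀ (b : B) (σ : Ω) (c : C), F₁.U (MulOpposite.op c • F₁.π b (t σ))
      = MulOpposite.op c • F₁.π (α b) (t σ))
    (hd : ∀ (b : B) (σ : Ω) (c : C), F₂.U (MulOpposite.op c • F₂.π b (d σ))
      = MulOpposite.op c • F₂.π (α b) (d σ)) :
    (F₁.directSum F₂).Decomposes α K fun σ => directSumMk F₁ F₂ (t σ) (d σ) where
  kernel_eq σ τ b := by rw [directSum_π_apply, cInner_directSumMk, hK]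
  kernel_eq' σ τ b := by rw [directSum_π_apply, cInner_directSumMk, hK']
  U_apply b σ c := by
    rw [directSum_π_apply, directSum_π_apply, op_smul_directSumMk, op_smul_directSumMk,
      directSum_U_apply, ht, hd]

variable {α : B ≃⋆ₐ[ℂ] B} {Ω : Type*} {K : Ω → Ω → B →L[ℂ] C}

lemma Decomposes.directSum_left {i : Ω → F₁.carrier} (h : F₁.Decomposes α K i) :
    (F₁.directSum F₂).Decomposes α K fun σ => directSumMk F₁ F₂ (i σ) 0 :=
  decomposes_directSum
    (fun σ τ b => by rw [cInner_zero_left, add_zero, h.kernel_eq])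
    (fun σ τ b => by rw [cInner_zero_right, add_zero, h.kernel_eq'])
    h.U_apply (fun b σ c => by simp only [map_zero, smul_zero])

lemma Decomposes.directSum_right {i : Ω → F₂.carrier} (h : F₂.Decomposes α K i) :
    (F₁.directSum F₂).Decomposes α K fun σ => directSumMk F₁ F₂ 0 (i σ) :=
  decomposes_directSum
    (fun σ τ b => by rw [cInner_zero_left, zero_add, h.kernel_eq])
    (fun σ τ b => by rw [cInner_zero_right, zero_add, h.kernel_eq'])
    (fun b σ c => by simp only [map_zero, smul_zero]) h.U_apply

end DirectSum

variable {B : Type u} [CStarAlgebra B] {H : Type v} [NormedAddCommGroup H] [InnerProductSpace ℂ H]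
  [CompleteSpace H] {C : VonNeumannAlgebra H} {α : B ≃⋆ₐ[ℂ] B} {Ω : Type*}

/-- `C`-linearity is automatic for an adjointable map; here it is read off from `U ⊗ 1` on `F ⊗ H`.
-/
lemma U_op_smul (F : SCorrespondence.{u, v, w} B C) (c : C) (x : F.carrier) :
    F.U (MulOpposite.op c • x) = MulOpposite.op c • F.U x := by
  obtain ⟨A, hA, -⟩ := F.exists_U_interior
  refine interiorL_injective C (ContinuousLinearMap.ext fun h => ?_)
  rw [interiorL_apply, interiorL_apply, ← hA, interiorTmul_op_smul, interiorTmul_op_smul, hA]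

/-- The vectors `b i(σ) ⊗ h` of the interior tensor product. -/
noncomputable def cyclicVector (F : SCorrespondence.{u, v, w} B C) (i : Ω → F.carrier)
    (a : B × Ω × H) : InteriorTensor C F.carrier :=
  interiorTmul C (F.π a.1 (i a.2.1)) a.2.2

section Cyclic

variable {F : SCorrespondence.{u, v, w} B C} {K : Ω → Ω → B →L[ℂ] C} {i : Ω → F.carrier}
  {A : InteriorTensor C F.carrier →L[ℂ] InteriorTensor C F.carrier}

lemma Decomposes.inner_cyclicVector (h : F.Decomposes α K i) (a b : B × Ω × H) :
    inner ℂ (F.cyclicVector i a) (F.cyclicVector i b)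
      = inner ℂ a.2.2 ((K a.2.1 b.2.1 (α (star a.1) * b.1) : H →L[ℂ] H) b.2.2) := by
  rw [cyclicVector, cyclicVector, inner_interiorTmul, h.cInner_π_π]

lemma π_cyclicVector {b : B}
    (hA : ∀ x h, A (interiorTmul C x h) = interiorTmul C (F.π b x) h) (a : B × Ω × H) :
    A (F.cyclicVector i a) = F.cyclicVector i (b * a.1, a.2) := by
  rw [cyclicVector, hA, cyclicVector, map_mul, Module.End.mul_apply]

/-- On cyclic vectors `U π(b*) U⁻¹` is left multiplication by `α(b*)`, so the adjoint acts by a map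
of indices that is the same for every decomposition. -/
lemma Decomposes.adjoint_π_cyclicVector (h : F.Decomposes α K i) {b : B}
    (hA : ∀ x h, adjoint A (interiorTmul C x h)
      = interiorTmul C (F.U (F.π (star b) (F.U.symm x))) h) (a : B × Ω × H) :
    adjoint A (F.cyclicVector i a) = F.cyclicVector i (α (star b) * a.1, a.2) := by
  rw [cyclicVector, hA, cyclicVector, h.U_symm_π, ← Module.End.mul_apply, ← map_mul, h.U_π,
    map_mul, StarAlgEquiv.apply_symm_apply]

lemma Decomposes.U_cyclicVector (h : F.Decomposes α K i)
    (hA : ∀ x h, A (interiorTmul C x h) = interiorTmul C (F.U x) h) (a : B × Ω × H) :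
    A (F.cyclicVector i a) = F.cyclicVector i (α a.1, a.2) := by
  rw [cyclicVector, hA, cyclicVector, h.U_π]

lemma Decomposes.adjoint_U_cyclicVector (h : F.Decomposes α K i)
    (hA : ∀ x h, adjoint A (interiorTmul C x h) = interiorTmul C (F.U.symm x) h)
    (a : B × Ω × H) :
    adjoint A (F.cyclicVector i a) = F.cyclicVector i (α.symm a.1, a.2) := by
  rw [cyclicVector, hA, cyclicVector, h.U_symm_π]

end Cyclic

set_option maxHeartbeats 1000000 in
/-- If `F` decomposes `K₁` through `j₁` and `K₂` through `j₂`, then `⟨j₁, j₂⟩` is implemented by a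
contraction `T` from `F₂ ⊗ H` to `F₁ ⊗ H`. With `D = (1 - T* T)^{1/2}`, the operators `T L_{i₂(σ)}`
and `D L_{i₂(σ)}` come from vectors in `F₁` and `F₂`. -/
lemma exists_contraction_of_common {K₁ K₂ : Ω → Ω → B →L[ℂ] C}
    {F₁ F₂ F : SCorrespondence.{u, v, w} B C}
    (hF₁ : IsVonNeumannModule C F₁.carrier) (hF₂ : IsVonNeumannModule C F₂.carrier)
    {i₁ : Ω → F₁.carrier} {i₂ : Ω → F₂.carrier} {j₁ j₂ : Ω → F.carrier}
    (h₁ : F₁.Decomposes α K₁ i₁) (h₂ : F₂.Decomposes α K₂ i₂)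
    (g₁ : F.Decomposes α K₁ j₁) (g₂ : F.Decomposes α K₂ j₂) :
    ∃ (T : InteriorTensor C F₂.carrier →L[ℂ] InteriorTensor C F₁.carrier)
      (D : InteriorTensor C F₂.carrier →L[ℂ] InteriorTensor C F₂.carrier)
      (t : Ω → F₁.carrier) (d : Ω → F₂.carrier),
      adjoint D = D ∧ adjoint T ∘L T + D ∘L D = 1 ∧
      (∀ a b, inner ℂ (F₁.cyclicVector i₁ a) (T (F₂.cyclicVector i₂ b))
        = inner ℂ (F.cyclicVector j₁ a) (F.cyclicVector j₂ b)) ∧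
      (∀ b σ, interiorL C (F₁.π b (t σ)) = T ∘L interiorL C (F₂.π b (i₂ σ))) ∧
      (∀ b σ, interiorL C (F₂.π b (d σ)) = D ∘L interiorL C (F₂.π b (i₂ σ))) ∧
      (∀ b σ, F₁.U (F₁.π b (t σ)) = F₁.π (α b) (t σ)) ∧
      ∀ b σ, F₂.U (F₂.π b (d σ)) = F₂.π (α b) (d σ) := by
  obtain ⟨T, D, hD, hTD, hT, hcomm⟩ := exists_contraction_of_inner_eq (ι := B × Ω × H)
    (F₁.cyclicVector i₁) (F₂.cyclicVector i₂) (F.cyclicVector j₁) (F.cyclicVector j₂)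
    (fun a b => by rw [h₁.inner_cyclicVector, g₁.inner_cyclicVector])
    (fun a b => by rw [h₂.inner_cyclicVector, g₂.inner_cyclicVector])
  choose P₁ hP₁ hP₁' using F₁.exists_π_interior
  choose P₂ hP₂ hP₂' using F₂.exists_π_interior
  have hTDP (b : B) : T ∘L P₂ b = P₁ b ∘L T ∧ D ∘L P₂ b = P₂ b ∘L D := by
    obtain ⟨P, hP, hP'⟩ := F.exists_π_interior b
    exact hcomm (P₁ b) (P₂ b) P (fun a => (b * a.1, a.2)) (fun a => (α (star b) * a.1, a.2))
      (π_cyclicVector (hP₁ b)) (h₁.adjoint_π_cyclicVector (hP₁' b))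
      (π_cyclicVector (hP₂ b)) (h₂.adjoint_π_cyclicVector (hP₂' b))
      (π_cyclicVector hP) (g₁.adjoint_π_cyclicVector hP')
      (π_cyclicVector hP) (g₂.adjoint_π_cyclicVector hP')
  obtain ⟨W₁, hW₁, hW₁'⟩ := F₁.exists_U_interior
  obtain ⟨W₂, hW₂, hW₂'⟩ := F₂.exists_U_interior
  have hTDW : T ∘L W₂ = W₁ ∘L T ∧ D ∘L W₂ = W₂ ∘L D := by
    obtain ⟨W, hW, hW'⟩ := F.exists_U_interior
    exact hcomm W₁ W₂ W (fun a => (α a.1, a.2)) (fun a => (α.symm a.1, a.2))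
      (h₁.U_cyclicVector hW₁) (h₁.adjoint_U_cyclicVector hW₁')
      (h₂.U_cyclicVector hW₂) (h₂.adjoint_U_cyclicVector hW₂')
      (g₁.U_cyclicVector hW) (g₁.adjoint_U_cyclicVector hW')
      (g₂.U_cyclicVector hW) (g₂.adjoint_U_cyclicVector hW')
  have hTDs (s : H →L[ℂ] H) (hs : s ∈ C.commutant)
      (R₁ : InteriorTensor C F₁.carrier →L[ℂ] InteriorTensor C F₁.carrier)
      (R₂ : InteriorTensor C F₂.carrier →L[ℂ] InteriorTensor C F₂.carrier)
      (hR₁ : ∀ x h, R₁ (interiorTmul C x h) = interiorTmul C x (s h))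
      (hR₂ : ∀ x h, R₂ (interiorTmul C x h) = interiorTmul C x (s h)) :
      T ∘L R₂ = R₁ ∘L T ∧ D ∘L R₂ = R₂ ∘L D := by
    obtain ⟨Q₁, hQ₁, hQ₁'⟩ := F₁.exists_commutant_interior hs
    obtain ⟨Q₂, hQ₂, hQ₂'⟩ := F₂.exists_commutant_interior hs
    obtain ⟨Q, hQ, hQ'⟩ := F.exists_commutant_interior hs
    obtain rfl : R₁ = Q₁ := interiorTensor_clm_ext C fun x h => by rw [hR₁, hQ₁]
    obtain rfl : R₂ = Q₂ := interiorTensor_clm_ext C fun x h => by rw [hR₂, hQ₂]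
    exact hcomm R₁ R₂ Q (fun a => (a.1, a.2.1, s a.2.2))
      (fun a => (a.1, a.2.1, adjoint s a.2.2)) (fun _ => hR₁ _ _) (fun _ => hQ₁' _ _)
      (fun _ => hR₂ _ _) (fun _ => hQ₂' _ _) (fun _ => hQ _ _) (fun _ => hQ' _ _)
      (fun _ => hQ _ _) (fun _ => hQ' _ _)
  -- `T L_{i₂(σ)}` intertwines `s` and `1 ⊗ s` because both factors do.
  have ht (σ : Ω) : ∃ x, interiorL C x = T ∘L interiorL C (i₂ σ) :=
    hF₁.exists_interiorL_eq C _ fun s hs R₁ hR₁ => by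
      obtain ⟨R₂, hR₂, -⟩ := F₂.exists_commutant_interior hs
      rw [← comp_assoc, ← (hTDs s hs R₁ R₂ hR₁ hR₂).1]
      ext h
      exact congrArg T (hR₂ (i₂ σ) h).symm
  have hd (σ : Ω) : ∃ x, interiorL C x = D ∘L interiorL C (i₂ σ) :=
    hF₂.exists_interiorL_eq C _ fun s hs R₂ hR₂ => by
      obtain ⟨R₁, hR₁, -⟩ := F₁.exists_commutant_interior hs
      rw [← comp_assoc, ← (hTDs s hs R₁ R₂ hR₁ hR₂).2]
      ext h
      exact congrArg D (hR₂ (i₂ σ) h).symm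
  choose t ht using ht
  choose d hd using hd
  have hL₁ (b : B) (x : F₁.carrier) := F₁.π_interior_comp_interiorL (hP₁ b) x
  have hL₂ (b : B) (x : F₂.carrier) := F₂.π_interior_comp_interiorL (hP₂ b) x
  have htπ (b : B) (σ : Ω) : interiorL C (F₁.π b (t σ)) = T ∘L interiorL C (F₂.π b (i₂ σ)) :=
    calc interiorL C (F₁.π b (t σ)) = (P₁ b ∘L T) ∘L interiorL C (i₂ σ) := by
          rw [← hL₁, ht, comp_assoc]
      _ = T ∘L interiorL C (F₂.π b (i₂ σ)) := by rw [← (hTDP b).1, comp_assoc, hL₂]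
  have hdπ (b : B) (σ : Ω) : interiorL C (F₂.π b (d σ)) = D ∘L interiorL C (F₂.π b (i₂ σ)) :=
    calc interiorL C (F₂.π b (d σ)) = (P₂ b ∘L D) ∘L interiorL C (i₂ σ) := by
          rw [← hL₂, hd, comp_assoc]
      _ = D ∘L interiorL C (F₂.π b (i₂ σ)) := by rw [← (hTDP b).2, comp_assoc, hL₂]
  have htU (b : B) (σ : Ω) : F₁.U (F₁.π b (t σ)) = F₁.π (α b) (t σ) := by
    refine interiorL_injective C ?_
    have h : interiorL C (F₁.U (F₁.π b (t σ))) = W₁ ∘L interiorL C (F₁.π b (t σ)) :=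
      ContinuousLinearMap.ext fun h => (hW₁ _ h).symm
    rw [h, htπ, htπ, ← h₂.U_π, ← comp_assoc, ← hTDW.1]
    ext h
    exact congrArg T (hW₂ _ h)
  have hdU (b : B) (σ : Ω) : F₂.U (F₂.π b (d σ)) = F₂.π (α b) (d σ) := by
    refine interiorL_injective C ?_
    have h : interiorL C (F₂.U (F₂.π b (d σ))) = W₂ ∘L interiorL C (F₂.π b (d σ)) :=
      ContinuousLinearMap.ext fun h => (hW₂ _ h).symm
    rw [h, hdπ, hdπ, ← h₂.U_π, ← comp_assoc, ← hTDW.2]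
    ext h
    exact congrArg D (hW₂ _ h)
  exact ⟨T, D, t, d, hD, hTD, hT, htπ, hdπ, htU, hdU⟩

set_option maxHeartbeats 1000000 in
/-- Any two decompositions of `K₁` and `K₂` through a common S-correspondence can be moved to
`F₁ ⊕ F₂` such that the first one becomes `i₁ ⊕ 0` and the distances do not change. -/
lemma exists_decomposes_directSum_norm_eq {K₁ K₂ : Ω → Ω → B →L[ℂ] C}
    {F₁ F₂ F : SCorrespondence.{u, v, w} B C}
    (hF₁ : IsVonNeumannModule C F₁.carrier) (hF₂ : IsVonNeumannModule C F₂.carrier)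
    {i₁ : Ω → F₁.carrier} {i₂ : Ω → F₂.carrier} {j₁ j₂ : Ω → F.carrier}
    (h₁ : F₁.Decomposes α K₁ i₁) (h₂ : F₂.Decomposes α K₂ i₂)
    (g₁ : F.Decomposes α K₁ j₁) (g₂ : F.Decomposes α K₂ j₂) :
    ∃ j : Ω → (F₁.directSum F₂).carrier, (F₁.directSum F₂).Decomposes α K₂ j ∧
      ∀ σ, ‖directSumMk F₁ F₂ (i₁ σ) 0 - j σ‖ = ‖j₁ σ - j₂ σ‖ := by
  obtain ⟨T, D, t, d, hD, hTD, hT, htπ, hdπ, htU, hdU⟩ :=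
    exists_contraction_of_common hF₁ hF₂ h₁ h₂ g₁ g₂
  have ht (σ : Ω) : interiorL C (t σ) = T ∘L interiorL C (i₂ σ) := by
    simpa only [map_one, Module.End.one_apply] using htπ 1 σ
  have hd (σ : Ω) : interiorL C (d σ) = D ∘L interiorL C (i₂ σ) := by
    simpa only [map_one, Module.End.one_apply] using hdπ 1 σ
  have hsum (σ τ : Ω) (b : B) : K₂ σ τ b
      = cInner C (t σ) (F₁.π b (t τ)) + cInner C (d σ) (F₂.π b (d τ)) := by
    refine Subtype.ext ?_
    change _ = (cInner C (t σ) (F₁.π b (t τ)) : H →L[ℂ] H) + (cInner C (d σ) (F₂.π b (d τ)))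
    rw [h₂.kernel_eq, ← adjoint_interiorL_comp C (t σ), ← adjoint_interiorL_comp C (d σ),
      ← adjoint_interiorL_comp C (i₂ σ), htπ, hdπ, ht, hd,
      adjoint_comp_add_adjoint_comp hD hTD]
  -- The second kernel formula for `i₂` is the adjoint of the first at `α(b*)` with the indices
  -- exchanged, so it follows from `hsum`.
  have hsum' (σ τ : Ω) (b : B) : K₂ σ τ b = cInner C (F₁.π (α (star b)) (t σ)) (t τ)
      + cInner C (F₂.π (α (star b)) (d σ)) (d τ) := by
    rw [h₂.kernel_eq', ← star_cInner, ← h₂.kernel_eq, hsum, star_add, star_cInner, star_cInner]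
  have hj : (F₁.directSum F₂).Decomposes α K₂ fun σ => directSumMk F₁ F₂ (t σ) (d σ) :=
    decomposes_directSum hsum hsum' (fun b σ c => by rw [U_op_smul, htU])
      (fun b σ c => by rw [U_op_smul, hdU])
  have hcross (σ : Ω) : cInner C (i₁ σ) (t σ) = cInner C (j₁ σ) (j₂ σ) := by
    refine Subtype.ext (ContinuousLinearMap.ext fun k => ext_inner_left ℂ fun h => ?_)
    rw [← inner_interiorTmul, ← inner_interiorTmul]
    -- At the index `b = 1` the cyclic vectors are `i(σ) ⊗ h`.
    have h3 := hT (1, σ, h) (1, σ, k)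
    simp only [cyclicVector, map_one, Module.End.one_apply] at h3
    rw [← h3]
    congr 1
    exact DFunLike.congr_fun (ht σ) k
  refine ⟨_, hj, fun σ => ?_⟩
  have hself : cInner C (directSumMk F₁ F₂ (i₁ σ) 0) (directSumMk F₁ F₂ (i₁ σ) 0)
      = cInner C (j₁ σ) (j₁ σ) := by
    rw [g₁.cInner_self, cInner_directSumMk, cInner_zero_left, add_zero, h₁.cInner_self]
  refine (sq_eq_sq₀ (norm_nonneg _) (norm_nonneg _)).mp ?_
  rw [norm_sq_eq_cInner (C := C), norm_sq_eq_cInner (C := C), cInner_sub_sub, cInner_sub_sub,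
    hself, hj.cInner_self, g₂.cInner_self, cInner_directSumMk, cInner_zero_left, add_zero, hcross]

end SCorrespondence

/-! ### Comparison of the infima -/

theorem mainTheorem7 {B : Type u} [CStarAlgebra B]
    {H : Type v} [NormedAddCommGroup H] [InnerProductSpace ℂ H] [CompleteSpace H]
    (C : VonNeumannAlgebra H) (α : B ≃⋆ₐ[ℂ] B) {Ω : Type*}
    (K₁ K₂ : Ω → Ω → B →L[ℂ] C) (hK₁ : IsAlphaCPD α K₁) (hK₂ : IsAlphaCPD α K₂)
    (F₁ F₂ : SCorrespondence.{u, v, w} B C) (i₁ : Ω → F₁.carrier) (i₂ : Ω → F₂.carrier)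
    (h₁ : IsKolmogorovDecomposition C α K₁ F₁ i₁)
    (h₂ : IsKolmogorovDecomposition C α K₂ F₂ i₂) :
    buresDist.{u, v, w} α K₁ K₂ = (F₁.directSum F₂).buresDistOn α K₁ K₂ ∧
    buresDist.{u, v, w} α K₁ K₂ =
      sInf {r : ℝ | ∃ j ∈ (F₁.directSum F₂).S α K₂, ∃ σ : Ω,
        r = ‖SCorrespondence.directSumMk F₁ F₂ (i₁ σ) 0 - j σ‖} := by
  set A := {r : ℝ | ∃ j ∈ (F₁.directSum F₂).S α K₂, ∃ σ : Ω,
    r = ‖SCorrespondence.directSumMk F₁ F₂ (i₁ σ) 0 - j σ‖} with hA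
  have hleft : (fun σ => SCorrespondence.directSumMk F₁ F₂ (i₁ σ) 0) ∈ (F₁.directSum F₂).S α K₁ :=
    h₁.decomposes.directSum_left
  have hright : (fun σ => SCorrespondence.directSumMk F₁ F₂ 0 (i₂ σ)) ∈ (F₁.directSum F₂).S α K₂ :=
    h₂.decomposes.directSum_right
  have hsub (F : SCorrespondence.{u, v, w} B C) :
      {r : ℝ | ∃ j₁ ∈ F.S α K₁, ∃ j₂ ∈ F.S α K₂, ∃ σ : Ω, r = ‖j₁ σ - j₂ σ‖} ⊆ A := by
    rintro _ ⟨j₁, hj₁, j₂, hj₂, σ, rfl⟩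
    obtain ⟨j, hj, hnorm⟩ := SCorrespondence.exists_decomposes_directSum_norm_eq
      h₁.isVonNeumannModule h₂.isVonNeumannModule h₁.decomposes h₂.decomposes hj₁ hj₂
    exact ⟨j, hj, σ, (hnorm σ).symm⟩
  have hsum : (F₁.directSum F₂).buresDistOn α K₁ K₂ = sInf A := by
    refine congrArg sInf (Set.Subset.antisymm (hsub _) ?_)
    rintro _ ⟨j, hj, σ, rfl⟩
    exact ⟨_, hleft, j, hj, σ, rfl⟩
  have hAbdd : BddBelow A := ⟨0, by rintro _ ⟨j, -, σ, rfl⟩; exact norm_nonneg _⟩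
  have hle (F : SCorrespondence.{u, v, w} B C) (hF : F.IsCommon α K₁ K₂) :
      sInf A ≤ F.buresDistOn α K₁ K₂ := by
    obtain ⟨⟨j₁, hj₁⟩, ⟨j₂, hj₂⟩⟩ := hF
    -- For empty `Ω` no distances exist and the real infimum of the empty set is `0`.
    rcases isEmpty_or_nonempty Ω with hΩ | ⟨⟨σ⟩⟩
    · have hAe : A = ∅ := Set.eq_empty_of_forall_notMem fun _ ⟨_, _, σ, _⟩ => hΩ.elim σ
      rw [hAe, Real.sInf_empty]
      exact Real.sInf_nonneg (by rintro _ ⟨_, _, _, _, σ, rfl⟩; exact norm_nonneg _)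
    · exact csInf_le_csInf hAbdd ⟨_, j₁, hj₁, j₂, hj₂, σ, rfl⟩ (hsub F)
  have hmain : buresDist.{u, v, w} α K₁ K₂ = sInf A := by
    -- `F₁ ⊕ F₂` is itself a common S-correspondence, so the outer infimum is attained there.
    refine IsLeast.csInf_eq ⟨⟨F₁.directSum F₂, ⟨⟨_, hleft⟩, ⟨_, hright⟩⟩, hsum.symm⟩, ?_⟩
    rintro _ ⟨F, hF, rfl⟩
    exact hle F hF
  exact ⟨hmain.trans hsum.symm, hmain⟩
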